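/- **Setting.** For $i\in\mathbb N$ let $H_i\in\mathbb F_2^{m_i\times n_i}$ and $G_i\in\mathbb F_2^{k_i\times n_i}$ with $G_iH_i^{T}=0$ and block lengths $n_i\to\infty$ (one side of a family of CSS codes). Write $|\cdot|$ for the Hamming weight and $\|x\|:=\min_{a\in\operatorname{Im}G_i^{T}}|x+a|$ for the reduced weight of $x\in\mathbb F_2^{n_i}$. For each class of $\mathbb F_2^{n_i}/\operatorname{Im}G_i^{T}$ fix a representative of smallest Hamming weight (ties broken arbitrarily), and let $x|_{\rm red}$ be the chosen representative of the class of $x$, so $|x|_{\rm red}|=\|x\|$. Assume: * each $H_i$ has full rank, i.e. $\operatorname{rank}H_i=m_i$ (no redundant checks); * the family $(H_i)$ is LDPC: the numbers of ones in each row and in each column of $H_i$ are bounded uniformly in $i$; * $(H_i)$ has linear $(\delta,\gamma)$-confinement with respect to the reduced weight: $\gamma>0$, the function $\delta:\mathbb N\to\mathbb R$ is monotonically increasing with $\log n=o(\delta(n))$, and $\|x\|\le\delta(n_i)$ implies $|H_ix|\ge\gamma\|x\|$ for all $i$ and all $x\in\mathbb F_2^{n_i}$. Call two distinct bits adjacent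 if they share a check (a row of $H_i$). For a set $A$ of bits, let $\mathrm{MaxConn}_{1/2}(A)$ be the largest size of a non-empty set $B$ of bits that induces a connected subgraph and satisfies $|A\cap B|\ge\frac12|B|$ (a connected $\frac12$-subset of $A$), and $0$ if there is none. Identifying vectors with their supports, put for $x_0\in\mathbb F_2^{n_i}$ $$\Omega(x_0)=\{x_0+x:\ \mathrm{MaxConn}_{1/2}(x|_{\rm red})\le\tfrac12\delta(n_i)\},\qquad \partial\Omega(x_0)=\{w\notin\Omega(x_0):\ \operatorname{dist}(w,\Omega(x_0))<\tfrac14\delta(n_i)\},$$ where $\operatorname{dist}$ is the Hamming distance. Let $\mu_G(x)=Z^{-1}e^{-\beta|H_ix|}$ be the Gibbs distribution of $H_i$ on $\mathbb F_2^{n_i}$ at inverse temperature $\beta$. **Theorem (Bottleneck around typical low-temperature states).** There exist $\beta^*,c_1,c>0$ such that for every $\beta>\beta^*$, if $x_0$ is sampled from $\mu_G$, then as $i\to\infty$, with probability $1-O(e^{-c_1\delta(n_i)})$, $$\frac{\mu_G[\partial\Omega(x_0)]}{\mu_G[\Omega(x_0)]}\le e^{-c\,\delta(n_i)},$$ and $e^{-c\,\delta(n_i)}\to0$.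 -/

import Mathlib

open Filter Asymptotics Topology

/-- Binary vectors of length `n`. -/
abbrev BitVect (n : ℕ) : Type := Fin n → ZMod 2

/-- A family of parity check matrices is LDPC: row weights and column weights are bounded by
integers that do not depend on the member of the family. -/
def IsLDPC {m N : ℕ → ℕ} (H : ∀ i, Matrix (Fin (m i)) (Fin (N i)) (ZMod 2)) : Prop :=
  ∃ wCheck wBit : ℕ, ∀ i,
    (∀ a, hammingNorm (fun j => H i a j) ≤ wCheck) ∧
    (∀ j, hammingNorm (fun a => H i a j) ≤ wBit)

/-- The image of `Gᵀ`, i.e. the row space of `G`. -/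
def rowSpace {k n : ℕ} (G : Matrix (Fin k) (Fin n) (ZMod 2)) : Submodule (ZMod 2) (BitVect n) :=
  LinearMap.range G.transpose.mulVecLin

/-- Reduced weight of `x`: the minimum of the Hamming weights `|x + a|`, `a ∈ Im Gᵀ`. -/
noncomputable def reducedWeight {k n : ℕ} (G : Matrix (Fin k) (Fin n) (ZMod 2))
    (x : BitVect n) : ℕ :=
  sInf {w : ℕ | ∃ a ∈ rowSpace G, w = hammingNorm (x + a)}

/-- `red` selects, in every class of `𝔽₂ⁿ / Im Gᵀ`, a representative of smallest Hamming weight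
(smallest representatives need not be unique, so this is a choice of tie-breaking). -/
structure IsReduction {k n : ℕ} (G : Matrix (Fin k) (Fin n) (ZMod 2))
    (red : BitVect n → BitVect n) : Prop where
  mem : ∀ x, x + red x ∈ rowSpace G
  weight : ∀ x, hammingNorm (red x) = reducedWeight G x
  congr : ∀ x y, x + y ∈ rowSpace G → red x = red y

/-- Linear confinement of a single check matrix `H` with respect to the reduced weight
given by `G`: `‖x‖ ≤ d` implies `|H x| ≥ γ ‖x‖`. -/
def Confined {m k n : ℕ} (H : Matrix (Fin m) (Fin n) (ZMod 2))
    (G : Matrix (Fin k) (Fin n) (ZMod 2)) (d γ : ℝ) : Prop :=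
  ∀ x : BitVect n, (reducedWeight G x : ℝ) ≤ d →
    γ * (reducedWeight G x : ℝ) ≤ (hammingNorm (H.mulVec x) : ℝ)

/-- Linear `(δ, γ)`-confinement of the family `H` (with respect to the reduced weights given by
the family `G`): `γ > 0`, the function `δ` is monotonically increasing and diverges
super-logarithmically, and the confinement inequality holds for each member. -/
structure HasLinearConfinement {m k N : ℕ → ℕ}
    (H : ∀ i, Matrix (Fin (m i)) (Fin (N i)) (ZMod 2))
    (G : ∀ i, Matrix (Fin (k i)) (Fin (N i)) (ZMod 2)) (δ : ℕ → ℝ) (γ : ℝ) : Prop where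
  gamma_pos : 0 < γ
  mono : Monotone δ
  superlog : (fun n : ℕ => Real.log (n : ℝ)) =o[atTop] δ
  confined : ∀ i, Confined (H i) (G i) (δ (N i)) γ

/-- The bit graph of `H`: two distinct bits are adjacent iff they share a check of `H`. -/
def bitGraph {m n : ℕ} (H : Matrix (Fin m) (Fin n) (ZMod 2)) : SimpleGraph (Fin n) where
  Adj a b := a ≠ b ∧ ∃ i, H i a ≠ 0 ∧ H i b ≠ 0
  symm := ⟨fun _ _ h => ⟨h.1.symm, h.2.imp fun _ hi => ⟨hi.2, hi.1⟩⟩⟩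
  loopless := ⟨fun _ h => h.1 rfl⟩

/-- `B` is an `α`-subset of `A`: `|A ∩ B| ≥ α |B|`. -/
def IsAlphaSubset {V : Type*} [DecidableEq V] (α : ℝ) (A B : Finset V) : Prop :=
  α * (B.card : ℝ) ≤ ((A ∩ B).card : ℝ)

open Classical in
/-- The size of the largest connected `α`-subset of `A` in the graph `Γ`
(`0` if there is none). -/
noncomputable def maxConn {V : Type*} [Fintype V] (Γ : SimpleGraph V) (α : ℝ) (A : Finset V) : ℕ :=
  ((Finset.univ : Finset (Finset V)).filter
    (fun B : Finset V => (Γ.induce (B : Set V)).Connected ∧ IsAlphaSubset α A B)).sup Finset.card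

/-- The set of bits on which `x` is non-zero. -/
def bitSupport {n : ℕ} (x : BitVect n) : Finset (Fin n) :=
  Finset.univ.filter fun j => x j ≠ 0

/-- `Ω(x₀)`: the configurations `x₀ + x` such that the reduced fluctuation `red x` has no connected
`1/2`-subset larger than `d / 2`. -/
def Omega {m n : ℕ} (H : Matrix (Fin m) (Fin n) (ZMod 2)) (red : BitVect n → BitVect n)
    (d : ℝ) (x₀ : BitVect n) : Set (BitVect n) :=
  {w | ∃ x, w = x₀ + x ∧ (maxConn (bitGraph H) (1 / 2) (bitSupport (red x)) : ℝ) ≤ d / 2}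

/-- `∂Ω(x₀)`: the configurations outside `Ω(x₀)` at Hamming distance less than `d / 4` from it. -/
def bdryOmega {m n : ℕ} (H : Matrix (Fin m) (Fin n) (ZMod 2)) (red : BitVect n → BitVect n)
    (d : ℝ) (x₀ : BitVect n) : Set (BitVect n) :=
  {w | w ∉ Omega H red d x₀ ∧ ∃ v ∈ Omega H red d x₀, (hammingDist w v : ℝ) < d / 4}

/-- Boltzmann weight `exp(-β |H x|)`. -/
noncomputable def boltzmann {m n : ℕ} (β : ℝ) (H : Matrix (Fin m) (Fin n) (ZMod 2))
    (x : BitVect n) : ℝ :=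
  Real.exp (-β * (hammingNorm (H.mulVec x) : ℝ))

/-- Probability of a set of configurations under the Gibbs distribution
`μ_G(x) = Z⁻¹ exp(-β |H x|)`. -/
noncomputable def gibbs {m n : ℕ} (β : ℝ) (H : Matrix (Fin m) (Fin n) (ZMod 2))
    (S : Set (BitVect n)) : ℝ :=
  (∑ x, S.indicator (boltzmann β H) x) / ∑ x, boltzmann β H x

/-- A choice of smallest representatives always exists. -/
theorem exists_isReduction {k n : ℕ} (G : Matrix (Fin k) (Fin n) (ZMod 2)) :
    ∃ red : BitVect n → BitVect n, IsReduction G red := by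
  classical
  have two : ∀ z : BitVect n, z + z = 0 := fun z => by
    funext j; exact CharTwo.add_self_eq_zero (z j)
  have key : ∀ x : BitVect n, ∃ r : BitVect n, x + r ∈ rowSpace G ∧
      hammingNorm r = reducedWeight G x := by
    intro x
    have hne : {w : ℕ | ∃ a ∈ rowSpace G, w = hammingNorm (x + a)}.Nonempty :=
      ⟨_, 0, Submodule.zero_mem _, rfl⟩
    obtain ⟨a, ha, hw⟩ := Nat.sInf_mem hne
    refine ⟨x + a, ?_, hw.symm⟩
    rw [← add_assoc, two, zero_add]
    exact ha
  choose f hf hfw using key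
  have hmk : ∀ x y : BitVect n,
      (Submodule.Quotient.mk x : BitVect n ⧸ rowSpace G) = Submodule.Quotient.mk y ↔
        x + y ∈ rowSpace G := by
    intro x y
    rw [Submodule.Quotient.eq]
    have : x - y = x + y := by
      rw [sub_eq_add_neg, neg_eq_of_add_eq_zero_left (two y)]
    rw [this]
  have hout : ∀ x : BitVect n,
      x + (Submodule.Quotient.mk x : BitVect n ⧸ rowSpace G).out ∈ rowSpace G := by
    intro x
    rw [← hmk]
    exact (Quotient.out_eq _).symm
  have hw : ∀ x y : BitVect n, x + y ∈ rowSpace G → reducedWeight G x = reducedWeight G y := by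
    intro x y hxy
    unfold reducedWeight
    congr 1
    ext w
    constructor
    · rintro ⟨a, ha, rfl⟩
      refine ⟨x + y + a, Submodule.add_mem _ hxy ha, ?_⟩
      congr 1
      calc x + a = (y + y) + x + a := by rw [two, zero_add]
        _ = y + (x + y + a) := by abel
    · rintro ⟨a, ha, rfl⟩
      refine ⟨x + y + a, Submodule.add_mem _ hxy ha, ?_⟩
      congr 1
      calc y + a = (x + x) + y + a := by rw [two, zero_add]
        _ = x + (x + y + a) := by abel
  refine ⟨fun x => f (Submodule.Quotient.mk x : BitVect n ⧸ rowSpace G).out, ?_, ?_, ?_⟩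
  · intro x
    have h := Submodule.add_mem _ (hout x)
      (hf (Submodule.Quotient.mk x : BitVect n ⧸ rowSpace G).out)
    have e : ∀ p q r : BitVect n, (p + q) + (q + r) = p + r := by
      intro p q r
      calc (p + q) + (q + r) = p + (q + q) + r := by abel
        _ = p + r := by rw [two, add_zero]
    rwa [e] at h
  · intro x
    rw [hfw]
    exact (hw _ _ (hout x)).symm
  · intro x y hxy
    have := (hmk x y).2 hxy
    simp only [this]

/-!
The theorem is a Peierls argument. Adding a large connected fluctuation to a typical
low-temperature state costs an energy proportional to its size, while the number of connected
fluctuations grows only exponentially in their size.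

*Where the energy comes from.* Let `w = x₀ + x` lie in `∂Ω(x₀)`. Then `x` is equivalent, modulo the
row space of `G`, to its reduced representative `s`, which has a connected half-subset `B` larger
than `d / 2` (with `d = δ n`), and also to `r + y`, where `r` is reduced without such a
half-subset and `|y| < d / 4`; such a pair is called tame (`IsTame`). Clusters of the union of the
supports of `r` and `y` have at most `d / 2` bits, because a larger one would be a half-subset of
`r`. Confinement on each of them
gives `|H (r + y)| ≥ γ (|r| - |y|)` (`IsTame.energy_ge`), with no bound on the size of `r`. On each
connected component `C` of the union of the supports of `s`, `r` and `y`, the restrictions of `s`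
and `r + y` have the same syndrome. A weight comparison shows that `|s|` on `C` exceeds
`|r| - |y|` on `C` by at most `2 |y| < d / 2`: on components of at most `d / 2` bits both
restrictions lie in the same class, larger ones have less than half of their bits in `r`, and
`|s| ≤ |r + y|` in total. So every component has energy at least `γ / 2` times its weight in `s`,
either by confinement applied to `s` or, above the confinement scale, by the estimate for `r + y`
(`IsTame.cluster_energy_ge`). Let `U` be the union of `B` and all components meeting it. It is
connected, and the part of `r + y` in `U` has energy at least `γ |U| / 11`
(`IsTame.exists_removable_piece`).

*The Peierls bound.* If the syndrome of `x₀` violates at most `γ |U| / 44` checks next to every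
large connected `U`, removing this part lowers the energy by `γ |U| / 22`. What remains of `r + y`
is again tame. The set of tame configurations is therefore closed under these removals, and no
control on the tie-breaking in the choice of reduced representatives is needed. Summing over `U`
and the removed part bounds the weight of the tame configurations outside `Ω(x₀)` by a small
factor times that of all tame ones (`sum_tameNbhd_diff_le`), hence by twice this factor times the
weight of `Ω(x₀)`.

*Typicality.* Full rank makes it possible to repair any set `T` of violated checks by a single
shift, so that `T` is violated with probability at most `exp (-β |T|)`; a union bound over `U` and
`T` shows that atypical syndromes are unlikely (`gibbs_atypical_le`).

*Entropy.* Both sums over connected sets are controlled by `sum_connectedSets_le`, which rests on a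
percolation argument (`sum_connected_through_vertex_le_one`). The factor `n` for the position of `U`
is absorbed because `δ` dominates the logarithm.
-/

/-! ### Counting connected sets of vertices -/

section Graph

variable {V : Type*}

/-- A connected set that meets `S` without being contained in it has an edge leaving `S`. -/
theorem exists_adj_leaving_of_connected {Γ : SimpleGraph V} {U : Set V}
    (hU : (Γ.induce U).Connected) {S : Set V} {a b : V} (ha : a ∈ U) (haS : a ∈ S)
    (hb : b ∈ U) (hbS : b ∉ S) : ∃ u ∈ U, ∃ v ∈ U, u ∈ S ∧ v ∉ S ∧ Γ.Adj u v := by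
  obtain ⟨p⟩ := hU.preconnected ⟨a, ha⟩ ⟨b, hb⟩
  obtain ⟨d, -, h1, h2⟩ := p.exists_boundary_dart {x | (x : V) ∈ S} haS hbS
  exact ⟨d.fst, d.fst.2, d.snd, d.snd.2, h1, h2, d.adj⟩

variable [Fintype V]

open Classical in
/-- The finsets of vertices inducing a connected subgraph and having more than `t` elements. -/
noncomputable def connectedSets (Γ : SimpleGraph V) (t : ℝ) : Finset (Finset V) :=
  Finset.univ.filter fun U => (Γ.induce (U : Set V)).Connected ∧ t < (U.card : ℝ)

open Classical in
/-- The vertices outside `U` adjacent to a vertex of `U`. -/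
noncomputable def outerBoundary (Γ : SimpleGraph V) (U : Finset V) : Finset V :=
  Finset.univ.filter fun v => v ∉ U ∧ ∃ u ∈ U, Γ.Adj u v

open Classical in
theorem card_outerBoundary_le {Γ : SimpleGraph V} {Δ : ℕ}
    (hΔ : ∀ v, (Finset.univ.filter fun w => Γ.Adj v w).card ≤ Δ) (U : Finset V) :
    (outerBoundary Γ U).card ≤ Δ * U.card := by
  have hsub : outerBoundary Γ U ⊆ U.biUnion fun v => Finset.univ.filter fun w => Γ.Adj v w := by
    intro v hv
    obtain ⟨-, -, u, hu, huv⟩ := Finset.mem_filter.1 hv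
    exact Finset.mem_biUnion.2 ⟨u, hu, by simpa using huv⟩
  calc (outerBoundary Γ U).card ≤ _ := Finset.card_le_card hsub
    _ ≤ U.card * Δ := Finset.card_biUnion_le_card_mul _ _ _ fun v _ => hΔ v
    _ = Δ * U.card := mul_comm _ _

open Classical in
/-- Percolation bound: in a graph of maximal degree `Δ`, the connected sets `U` through a fixed
vertex satisfy `∑ 2 ^ (-(Δ + 1) |U|) ≤ 1`. If every vertex is open with probability `1 / 2`, the
events "`U` is open and its outer boundary is closed" are pairwise disjoint, and the `U`-th one
has probability at least `2 ^ (-(Δ + 1) |U|)`. -/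
theorem sum_connected_through_vertex_le_one {Γ : SimpleGraph V} {Δ : ℕ}
    (hΔ : ∀ v, (Finset.univ.filter fun w => Γ.Adj v w).card ≤ Δ) (v : V) :
    ∑ U ∈ Finset.univ.filter (fun U : Finset V => (Γ.induce (U : Set V)).Connected ∧ v ∈ U),
      ((1 / 2 : ℝ) ^ (Δ + 1)) ^ U.card ≤ 1 := by
  set 𝒞 := Finset.univ.filter (fun U : Finset V => (Γ.induce (U : Set V)).Connected ∧ v ∈ U)
  -- The sets of open vertices for which `U` is open and its outer boundary is closed.
  let ev : Finset V → Finset (Finset V) := fun U => Finset.Icc U (outerBoundary Γ U)ᶜ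
  have hsubset : ∀ U ∈ 𝒞, ∀ U' ∈ 𝒞, ∀ ω, ω ∈ ev U → ω ∈ ev U' → U ⊆ U' := by
    intro U hU U' hU' ω hω hω'
    obtain ⟨-, hUc, hvU⟩ := Finset.mem_filter.1 hU
    obtain ⟨-, -, hvU'⟩ := Finset.mem_filter.1 hU'
    by_contra hnot
    obtain ⟨b, hb, hb'⟩ := Finset.not_subset.1 hnot
    obtain ⟨p, -, q, hq, hpS, hqS, hadj⟩ := exists_adj_leaving_of_connected (S := (U' : Set V))
      hUc (Finset.mem_coe.2 hvU) (Finset.mem_coe.2 hvU') (Finset.mem_coe.2 hb) (by simpa using hb')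
    have hqω : q ∈ ω := (Finset.mem_Icc.1 hω).1 hq
    have := (Finset.mem_Icc.1 hω').2 hqω
    exact (Finset.mem_compl.1 this)
      (Finset.mem_filter.2 ⟨Finset.mem_univ _, by simpa using hqS, p, by simpa using hpS, hadj⟩)
  have hdisj : (𝒞 : Set (Finset V)).PairwiseDisjoint ev := by
    intro U hU U' hU' hne
    refine Finset.disjoint_left.2 fun ω hω hω' => hne ?_
    exact Finset.Subset.antisymm (hsubset U hU U' hU' ω hω hω') (hsubset U' hU' U hU ω hω' hω)
  have hcard : ∀ U ∈ 𝒞, (2 : ℝ) ^ Fintype.card V * ((1 / 2 : ℝ) ^ (Δ + 1)) ^ U.card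
      ≤ ((ev U).card : ℝ) := by
    intro U _
    have hle : U ⊆ (outerBoundary Γ U)ᶜ := fun u hu => by
      simp only [Finset.mem_compl, outerBoundary, Finset.mem_filter]
      tauto
    have hb := card_outerBoundary_le hΔ U
    have hc := Finset.card_compl (outerBoundary Γ U)
    have hl := Finset.card_le_univ (outerBoundary Γ U)
    have hl' := Finset.card_le_card hle
    rw [Finset.card_Icc_finset hle, hc]
    push_cast
    rw [← pow_mul, one_div, inv_pow, ← div_eq_mul_inv, div_le_iff₀ (by positivity), ← pow_add]
    refine pow_le_pow_right₀ (by norm_num) ?_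
    rw [add_mul, one_mul]
    omega
  have htot : (∑ U ∈ 𝒞, ((ev U).card : ℝ)) ≤ 2 ^ Fintype.card V := by
    rw [← Nat.cast_sum, ← Finset.card_biUnion hdisj]
    calc (((𝒞.biUnion ev).card : ℕ) : ℝ) ≤ (Fintype.card (Finset V) : ℕ) := by
          exact_mod_cast Finset.card_le_univ _
      _ = 2 ^ Fintype.card V := by simp
  have hpos : (0 : ℝ) < 2 ^ Fintype.card V := by positivity
  refine le_of_mul_le_mul_left ?_ hpos
  rw [Finset.mul_sum, mul_one]
  exact (Finset.sum_le_sum hcard).trans htot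

open Classical in
/-- The cluster expansion estimate: when the cost per vertex `a` beats the entropy
`(Δ + 1) log 2` by at least `κ`, the connected sets with more than `t` vertices have total weight at
most `|V| exp (-κ t)`. -/
theorem sum_connectedSets_le {Γ : SimpleGraph V} {Δ : ℕ}
    (hΔ : ∀ v, (Finset.univ.filter fun w => Γ.Adj v w).card ≤ Δ) {a κ t : ℝ} (hκ : 0 ≤ κ)
    (ha : κ + (Δ + 1) * Real.log 2 ≤ a) :
    ∑ U ∈ connectedSets Γ t, Real.exp (-a * U.card) ≤ Fintype.card V * Real.exp (-κ * t) := by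
  have hpow : ∀ U : Finset V,
      ((1 / 2 : ℝ) ^ (Δ + 1)) ^ U.card = Real.exp (-((Δ + 1) * Real.log 2) * U.card) := by
    intro U
    have h2 : (1 / 2 : ℝ) = Real.exp (-Real.log 2) := by
      rw [Real.exp_neg, Real.exp_log (by norm_num), one_div]
    rw [h2, ← Real.exp_nat_mul, ← Real.exp_nat_mul]
    congr 1
    push_cast
    ring
  have hterm : ∀ U ∈ connectedSets Γ t, Real.exp (-a * U.card) ≤
      Real.exp (-κ * t) * ((1 / 2 : ℝ) ^ (Δ + 1)) ^ U.card := by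
    intro U hU
    obtain ⟨-, -, hUt⟩ := Finset.mem_filter.1 hU
    rw [hpow, ← Real.exp_add, Real.exp_le_exp]
    nlinarith [mul_le_mul_of_nonneg_right ha (Nat.cast_nonneg (α := ℝ) U.card),
      mul_le_mul_of_nonneg_left hUt.le hκ]
  have hcover : ∑ U ∈ connectedSets Γ t, ((1 / 2 : ℝ) ^ (Δ + 1)) ^ U.card ≤
      ∑ v : V, ∑ U ∈ Finset.univ.filter
        (fun U : Finset V => (Γ.induce (U : Set V)).Connected ∧ v ∈ U),
        ((1 / 2 : ℝ) ^ (Δ + 1)) ^ U.card := by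
    have hswap : ∑ v : V, ∑ U ∈ Finset.univ.filter
          (fun U : Finset V => (Γ.induce (U : Set V)).Connected ∧ v ∈ U),
          ((1 / 2 : ℝ) ^ (Δ + 1)) ^ U.card =
        ∑ U ∈ Finset.univ.filter (fun U : Finset V => (Γ.induce (U : Set V)).Connected),
          ∑ v ∈ U, ((1 / 2 : ℝ) ^ (Δ + 1)) ^ U.card :=
      Finset.sum_comm' fun v U => by simp [and_comm]
    rw [hswap]
    refine (Finset.sum_le_sum fun U hU => ?_).trans
      (Finset.sum_le_sum_of_subset_of_nonneg ?_ fun _ _ _ =>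
        Finset.sum_nonneg fun _ _ => by positivity)
    · obtain ⟨-, hUc, -⟩ := Finset.mem_filter.1 hU
      obtain ⟨v, hv⟩ := hUc.nonempty
      exact Finset.single_le_sum (f := fun _ => ((1 / 2 : ℝ) ^ (Δ + 1)) ^ U.card)
        (fun _ _ => by positivity) (Finset.mem_coe.1 hv)
    · intro U hU
      obtain ⟨-, hUc, -⟩ := Finset.mem_filter.1 hU
      exact Finset.mem_filter.2 ⟨Finset.mem_univ _, hUc⟩
  calc ∑ U ∈ connectedSets Γ t, Real.exp (-a * U.card)
      ≤ ∑ U ∈ connectedSets Γ t, Real.exp (-κ * t) * ((1 / 2 : ℝ) ^ (Δ + 1)) ^ U.card :=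
        Finset.sum_le_sum hterm
    _ = Real.exp (-κ * t) * ∑ U ∈ connectedSets Γ t, ((1 / 2 : ℝ) ^ (Δ + 1)) ^ U.card := by
        rw [Finset.mul_sum]
    _ ≤ Real.exp (-κ * t) * ∑ _v : V, (1 : ℝ) := by
        gcongr
        exact hcover.trans (Finset.sum_le_sum fun v _ => sum_connected_through_vertex_le_one hΔ v)
    _ = Fintype.card V * Real.exp (-κ * t) := by simp [mul_comm]

end Graph

/-! ### Clusters of a set of vertices -/

/-- The edges of `Γ` with both ends in `A`, as a graph on all vertices: its connected components
are the clusters of `A`, together with the singletons outside `A`. -/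
def clusterGraph {V : Type*} (Γ : SimpleGraph V) (A : Finset V) : SimpleGraph V where
  Adj a b := Γ.Adj a b ∧ a ∈ A ∧ b ∈ A
  symm := ⟨fun _ _ h => ⟨h.1.symm, h.2.2, h.2.1⟩⟩
  loopless := ⟨fun _ h => h.1.ne rfl⟩

/-- The label of the cluster of `A` containing a given vertex. -/
def cluster {V : Type*} (Γ : SimpleGraph V) (A : Finset V) (v : V) :
    (clusterGraph Γ A).ConnectedComponent :=
  (clusterGraph Γ A).connectedComponentMk v

theorem cluster_eq_of_adj {V : Type*} {Γ : SimpleGraph V} {A : Finset V} {a b : V} (h : Γ.Adj a b)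
    (ha : a ∈ A) (hb : b ∈ A) : cluster Γ A a = cluster Γ A b :=
  SimpleGraph.ConnectedComponent.sound (SimpleGraph.Adj.reachable (G := clusterGraph Γ A)
    (show (clusterGraph Γ A).Adj a b from ⟨h, ha, hb⟩))

theorem eq_or_mem_of_cluster_eq {V : Type*} {Γ : SimpleGraph V} {A : Finset V} {a b : V}
    (h : cluster Γ A a = cluster Γ A b) : a = b ∨ (a ∈ A ∧ b ∈ A) := by
  obtain ⟨p⟩ := SimpleGraph.ConnectedComponent.exact h
  have key : ∀ {u v : V}, (clusterGraph Γ A).Walk u v → u = v ∨ (u ∈ A ∧ v ∈ A) := by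
    intro u v p
    induction p with
    | nil => exact Or.inl rfl
    | cons hadj q ih =>
      rcases ih with rfl | ih
      · exact Or.inr ⟨hadj.2.1, hadj.2.2⟩
      · exact Or.inr ⟨hadj.2.1, ih.2⟩
  exact key p

theorem connected_induce_cluster {V : Type*} {Γ : SimpleGraph V} {A : Finset V}
    (c : (clusterGraph Γ A).ConnectedComponent) :
    (Γ.induce {v | cluster Γ A v = c}).Connected := by
  have h : ((clusterGraph Γ A).induce {v | cluster Γ A v = c}).Connected :=
    c.connected_toSimpleGraph
  refine h.mono (G' := Γ.induce {v | cluster Γ A v = c}) fun a b hab => ?_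
  exact (show (clusterGraph Γ A).Adj a b from hab).1

/-- A connected set stays connected when all clusters meeting it are added. -/
theorem connected_induce_cluster_hull {V : Type*} {Γ : SimpleGraph V} {A : Finset V} {B : Set V}
    (hB : (Γ.induce B).Connected) :
    (Γ.induce {v | ∃ b ∈ B, cluster Γ A v = cluster Γ A b}).Connected := by
  obtain ⟨⟨u, hu⟩⟩ := hB.nonempty
  refine Γ.induce_connected_of_patches u ⟨u, hu, rfl⟩ ?_
  rintro v ⟨b, hb, hvb⟩
  refine ⟨B ∪ {w | cluster Γ A w = cluster Γ A b}, ?_, Or.inl hu, Or.inr hvb, ?_⟩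
  · rintro w (hw | hw)
    · exact ⟨w, hw, rfl⟩
    · exact ⟨b, hb, hw⟩
  · exact (Γ.induce_union_connected hB.preconnected
      (connected_induce_cluster _).preconnected ⟨b, hb, rfl⟩).preconnected _ _

/-! ### Hamming weight and restriction of binary vectors -/

theorem bitVect_add_self {n : ℕ} (x : BitVect n) : x + x = 0 := by
  funext j
  exact CharTwo.add_self_eq_zero (x j)

theorem bitVect_add_cancel {n : ℕ} (x y : BitVect n) : x + (x + y) = y := by
  rw [← add_assoc, bitVect_add_self, zero_add]

theorem mem_bitSupport {n : ℕ} {x : BitVect n} {j : Fin n} : j ∈ bitSupport x ↔ x j ≠ 0 := by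
  simp [bitSupport]

theorem card_bitSupport {n : ℕ} (x : BitVect n) : (bitSupport x).card = hammingNorm x := rfl

theorem bitSupport_add_subset {n : ℕ} (x y : BitVect n) :
    bitSupport (x + y) ⊆ bitSupport x ∪ bitSupport y := by
  intro j hj
  rw [Finset.mem_union, mem_bitSupport, mem_bitSupport]
  rw [mem_bitSupport, Pi.add_apply] at hj
  by_contra! h
  exact hj (by rw [h.1, h.2, add_zero])

theorem hammingNorm_add_le {n : ℕ} (x y : BitVect n) :
    hammingNorm (x + y) ≤ hammingNorm x + hammingNorm y :=
  (Finset.card_le_card (bitSupport_add_subset x y)).trans (Finset.card_union_le _ _)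

/-- The restriction of a binary vector to a set of bits. -/
def restr {n : ℕ} (U : Finset (Fin n)) (x : BitVect n) : BitVect n :=
  fun j => if j ∈ U then x j else 0

theorem bitSupport_restr {n : ℕ} (U : Finset (Fin n)) (x : BitVect n) :
    bitSupport (restr U x) = bitSupport x ∩ U := by
  ext j
  simp only [mem_bitSupport, restr, Finset.mem_inter]
  by_cases h : j ∈ U <;> simp [h]

theorem bitSupport_restr_subset {n : ℕ} (U : Finset (Fin n)) (x : BitVect n) :
    bitSupport (restr U x) ⊆ bitSupport x := by
  rw [bitSupport_restr]
  exact Finset.inter_subset_left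

theorem hammingNorm_restr {n : ℕ} (U : Finset (Fin n)) (x : BitVect n) :
    hammingNorm (restr U x) = (bitSupport x ∩ U).card := by
  rw [← card_bitSupport, bitSupport_restr]

theorem hammingNorm_restr_le {n : ℕ} (U : Finset (Fin n)) (x : BitVect n) :
    hammingNorm (restr U x) ≤ hammingNorm x :=
  Finset.card_le_card (bitSupport_restr_subset U x)

theorem hammingNorm_restr_le_card {n : ℕ} (U : Finset (Fin n)) (x : BitVect n) :
    hammingNorm (restr U x) ≤ U.card := by
  rw [hammingNorm_restr]
  exact Finset.card_le_card Finset.inter_subset_right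

theorem restr_add {n : ℕ} (U : Finset (Fin n)) (x y : BitVect n) :
    restr U (x + y) = restr U x + restr U y := by
  funext j
  simp only [restr, Pi.add_apply]
  split_ifs <;> simp

theorem restr_add_restr_compl {n : ℕ} (U : Finset (Fin n)) (x : BitVect n) :
    restr U x + restr Uᶜ x = x := by
  funext j
  simp only [restr, Pi.add_apply, Finset.mem_compl]
  by_cases h : j ∈ U <;> simp [h]

theorem add_restr {n : ℕ} (U : Finset (Fin n)) (x : BitVect n) :
    x + restr U x = restr Uᶜ x := by
  conv_lhs => rw [← restr_add_restr_compl U x]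
  funext j
  simp only [restr, Pi.add_apply, Finset.mem_compl]
  by_cases h : j ∈ U
  · simp [h, CharTwo.add_self_eq_zero]
  · simp [h]

theorem hammingNorm_restr_add_compl {n : ℕ} (U : Finset (Fin n)) (x : BitVect n) :
    hammingNorm (restr U x) + hammingNorm (restr Uᶜ x) = hammingNorm x := by
  rw [hammingNorm_restr, hammingNorm_restr, ← card_bitSupport]
  have : bitSupport x ∩ Uᶜ = bitSupport x \ U := by
    ext; simp
  rw [this, Finset.card_inter_add_card_sdiff]

open Classical in
/-- The block of bits with a label in `S`. -/
noncomputable def block {n : ℕ} {ι : Type*} (p : Fin n → ι) (S : Finset ι) : Finset (Fin n) :=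
  Finset.univ.filter fun j => p j ∈ S

theorem mem_block {n : ℕ} {ι : Type*} {p : Fin n → ι} {S : Finset ι} {j : Fin n} :
    j ∈ block p S ↔ p j ∈ S := by
  simp [block]

open Classical in
theorem sum_hammingNorm_restr_block {n : ℕ} {ι : Type*} (p : Fin n → ι)
    (S : Finset ι) (x : BitVect n) :
    ∑ c ∈ S, hammingNorm (restr (block p {c}) x) = hammingNorm (restr (block p S) x) := by
  rw [hammingNorm_restr, Finset.card_eq_sum_card_fiberwise (f := p) (t := S)]
  · refine Finset.sum_congr rfl fun c hc => ?_
    rw [hammingNorm_restr]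
    congr 1
    ext j
    simp only [Finset.mem_inter, mem_block, Finset.mem_singleton, Finset.mem_filter]
    constructor
    · rintro ⟨h1, rfl⟩; exact ⟨⟨h1, hc⟩, rfl⟩
    · rintro ⟨⟨h1, -⟩, h2⟩; exact ⟨h1, h2⟩
  · intro j hj
    exact mem_block.1 (Finset.mem_inter.1 (Finset.mem_coe.1 hj)).2

theorem restr_block_univ {n : ℕ} {ι : Type*} [Fintype ι] (p : Fin n → ι) (x : BitVect n) :
    restr (block p Finset.univ) x = x := by
  funext j
  simp [restr, mem_block]

/-! ### Syndromes of separated pieces -/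

/-- No check of `H` sees two bits of the support of `x` with different labels. -/
def Separates {m n : ℕ} {ι : Type*} (H : Matrix (Fin m) (Fin n) (ZMod 2)) (p : Fin n → ι)
    (x : BitVect n) : Prop :=
  ∀ i a b, x a ≠ 0 → x b ≠ 0 → H i a ≠ 0 → H i b ≠ 0 → p a = p b

theorem Separates.of_cluster {m n : ℕ} {H : Matrix (Fin m) (Fin n) (ZMod 2)}
    {A : Finset (Fin n)} {x : BitVect n} (hx : bitSupport x ⊆ A) :
    Separates H (cluster (bitGraph H) A) x := by
  intro i a b ha hb hia hib
  by_cases hab : a = b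
  · rw [hab]
  · exact cluster_eq_of_adj ⟨hab, i, hia, hib⟩ (hx (mem_bitSupport.2 ha)) (hx (mem_bitSupport.2 hb))

open Classical in
/-- Each check sees at most one piece of a separated vector. -/
theorem Separates.mulVec_restr_apply {m n : ℕ} {ι : Type*}
    {H : Matrix (Fin m) (Fin n) (ZMod 2)} {p : Fin n → ι} {x : BitVect n}
    (h : Separates H p x) (i : Fin m) :
    (∀ S : Finset ι, H.mulVec (restr (block p S) x) i = 0) ∨
    ∃ c, ∀ S : Finset ι, H.mulVec (restr (block p S) x) i = if c ∈ S then H.mulVec x i else 0 := by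
  by_cases hex : ∃ a, H i a ≠ 0 ∧ x a ≠ 0
  · obtain ⟨a, hia, hxa⟩ := hex
    refine Or.inr ⟨p a, fun S => ?_⟩
    simp only [Matrix.mulVec, dotProduct]
    split_ifs with hS
    · refine Finset.sum_congr rfl fun b _ => ?_
      by_cases hib : H i b = 0
      · simp [hib]
      by_cases hxb : x b = 0
      · simp [restr, hxb]
      have := h i a b hxa hxb hia hib
      simp [restr, mem_block, ← this, hS]
    · refine Finset.sum_eq_zero fun b _ => ?_
      by_cases hib : H i b = 0
      · simp [hib]
      by_cases hxb : x b = 0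
      · simp [restr, hxb]
      have := h i a b hxa hxb hia hib
      simp [restr, mem_block, ← this, hS]
  · push Not at hex
    refine Or.inl fun S => ?_
    simp only [Matrix.mulVec, dotProduct]
    refine Finset.sum_eq_zero fun b _ => ?_
    by_cases hib : H i b = 0
    · simp [hib]
    · simp [restr, hex b hib]

theorem hammingNorm_eq_sum_ite {m : ℕ} (s : BitVect m) :
    hammingNorm s = ∑ i, if s i ≠ 0 then 1 else 0 := by
  simp [hammingNorm, Finset.card_filter]

open Classical in
theorem Separates.hammingNorm_mulVec_restr {m n : ℕ} {ι : Type*}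
    {H : Matrix (Fin m) (Fin n) (ZMod 2)} {p : Fin n → ι} {x : BitVect n}
    (h : Separates H p x) (S : Finset ι) :
    hammingNorm (H.mulVec (restr (block p S) x)) =
      ∑ c ∈ S, hammingNorm (H.mulVec (restr (block p {c}) x)) := by
  simp only [hammingNorm_eq_sum_ite]
  rw [Finset.sum_comm]
  refine Finset.sum_congr rfl fun i _ => ?_
  rcases h.mulVec_restr_apply i with h0 | ⟨c, hc⟩
  · simp [h0]
  · by_cases hx : H.mulVec x i = 0
    · simp [hc, hx]
    · simp only [hc, Finset.mem_singleton]
      have h1 : ∀ c', (if (if c = c' then H.mulVec x i else 0) ≠ 0 then 1 else 0) =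
          if c = c' then 1 else 0 := by
        intro c'
        by_cases hcc : c = c' <;> simp [hcc, hx]
      simp only [h1, Finset.sum_ite_eq]
      by_cases hcS : c ∈ S <;> simp [hcS, hx]

/-- Removing a separated piece `z` of `x` from the configuration `s` lowers the number of violated
checks by the syndrome weight of the piece, up to twice the number of its checks that `s`
violates itself. -/
theorem Separates.energy_drop {m n : ℕ} {ι : Type*}
    {H : Matrix (Fin m) (Fin n) (ZMod 2)} {p : Fin n → ι} {x : BitVect n}
    (h : Separates H p x) (S : Finset ι) (s : BitVect m) :
    hammingNorm (s + H.mulVec (x + restr (block p S) x)) +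
        hammingNorm (H.mulVec (restr (block p S) x)) ≤
      hammingNorm (s + H.mulVec x) +
        2 * (bitSupport s ∩ bitSupport (H.mulVec (restr (block p S) x))).card := by
  classical
  have hcard : (bitSupport s ∩ bitSupport (H.mulVec (restr (block p S) x))).card =
      ∑ i, if s i ≠ 0 ∧ H.mulVec (restr (block p S) x) i ≠ 0 then 1 else 0 := by
    rw [← Finset.card_filter]
    congr 1
    ext i
    simp [mem_bitSupport]
  rw [hcard, hammingNorm_eq_sum_ite, hammingNorm_eq_sum_ite, hammingNorm_eq_sum_ite,
    ← Finset.sum_add_distrib, Finset.mul_sum, ← Finset.sum_add_distrib]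
  refine Finset.sum_le_sum fun i _ => ?_
  have htwo : ∀ t : ZMod 2, t = 0 ∨ t = 1 := by decide
  have h11 : (1 : ZMod 2) + 1 = 0 := by decide
  have key : H.mulVec (restr (block p S) x) i = 0 ∨
      H.mulVec (restr (block p S) x) i = H.mulVec x i := by
    rcases h.mulVec_restr_apply i with h0 | ⟨c, hc⟩
    · exact Or.inl (h0 S)
    · rw [hc]
      by_cases hcS : c ∈ S <;> simp [hcS]
  rw [Matrix.mulVec_add]
  simp only [Pi.add_apply]
  rcases key with h0 | h1
  · simp [h0]
  · simp only [h1]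
    rcases htwo (H.mulVec x i) with hx | hx <;> rcases htwo (s i) with hs | hs <;>
      simp [hx, hs, h11]

/-! ### Reduced vectors -/

/-- `r` has smallest Hamming weight in its class modulo the row space of `G`. -/
def IsReducedVec {k n : ℕ} (G : Matrix (Fin k) (Fin n) (ZMod 2)) (r : BitVect n) : Prop :=
  ∀ a ∈ rowSpace G, hammingNorm r ≤ hammingNorm (r + a)

theorem reducedWeight_le_add {k n : ℕ} (G : Matrix (Fin k) (Fin n) (ZMod 2)) (x : BitVect n)
    {a : BitVect n} (ha : a ∈ rowSpace G) : reducedWeight G x ≤ hammingNorm (x + a) :=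
  Nat.sInf_le ⟨a, ha, rfl⟩

theorem reducedWeight_le {k n : ℕ} (G : Matrix (Fin k) (Fin n) (ZMod 2)) (x : BitVect n) :
    reducedWeight G x ≤ hammingNorm x := by
  simpa using reducedWeight_le_add G x (Submodule.zero_mem _)

theorem exists_reducedWeight_eq {k n : ℕ} (G : Matrix (Fin k) (Fin n) (ZMod 2))
    (x : BitVect n) : ∃ a ∈ rowSpace G, reducedWeight G x = hammingNorm (x + a) :=
  Nat.sInf_mem (s := {w : ℕ | ∃ a ∈ rowSpace G, w = hammingNorm (x + a)})
    ⟨_, 0, Submodule.zero_mem _, rfl⟩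

theorem IsReducedVec.reducedWeight_eq {k n : ℕ} {G : Matrix (Fin k) (Fin n) (ZMod 2)}
    {r : BitVect n} (h : IsReducedVec G r) : reducedWeight G r = hammingNorm r := by
  obtain ⟨a, ha, hw⟩ := exists_reducedWeight_eq G r
  exact le_antisymm (reducedWeight_le G r) (hw ▸ h a ha)

theorem IsReduction.isReducedVec {k n : ℕ} {G : Matrix (Fin k) (Fin n) (ZMod 2)}
    {red : BitVect n → BitVect n} (h : IsReduction G red) (x : BitVect n) :
    IsReducedVec G (red x) := by
  intro a ha
  rw [h.weight]
  have := reducedWeight_le_add G x (Submodule.add_mem _ (h.mem x) ha)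
  rwa [add_assoc, bitVect_add_cancel] at this

/-- A part of a reduced vector is reduced: a lighter representative of the part would give a
lighter representative of the whole. -/
theorem IsReducedVec.restriction {k n : ℕ} {G : Matrix (Fin k) (Fin n) (ZMod 2)}
    {r : BitVect n} (h : IsReducedVec G r) (U : Finset (Fin n)) :
    IsReducedVec G (restr U r) := by
  intro a ha
  have h1 := h a ha
  have h2 := hammingNorm_restr_add_compl U r
  have h3 : r + a = (restr U r + a) + restr Uᶜ r := by
    conv_lhs => rw [← restr_add_restr_compl U r]
    abel
  have h4 := hammingNorm_add_le (restr U r + a) (restr Uᶜ r)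
  rw [← h3] at h4
  omega

/-- Adding `y` lowers the reduced weight of a reduced vector by at most `|y|`. -/
theorem IsReducedVec.le_reducedWeight_add {k n : ℕ} {G : Matrix (Fin k) (Fin n) (ZMod 2)}
    {r : BitVect n} (h : IsReducedVec G r) (y : BitVect n) :
    hammingNorm r ≤ reducedWeight G (r + y) + hammingNorm y := by
  obtain ⟨a, ha, hw⟩ := exists_reducedWeight_eq G (r + y)
  have h1 := h a ha
  have h2 : r + a = (r + y + a) + y := by
    calc r + a = r + a + (y + y) := by rw [bitVect_add_self, add_zero]
      _ = (r + y + a) + y := by abel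
  have h3 := hammingNorm_add_le (r + y + a) y
  rw [← h2] at h3
  omega

theorem mulVec_eq_zero_of_mem_rowSpace {m k n : ℕ} {H : Matrix (Fin m) (Fin n) (ZMod 2)}
    {G : Matrix (Fin k) (Fin n) (ZMod 2)} (hGH : G * H.transpose = 0) {a : BitVect n}
    (ha : a ∈ rowSpace G) : H.mulVec a = 0 := by
  obtain ⟨v, rfl⟩ := ha
  have h : H * G.transpose = 0 := by
    rw [← Matrix.transpose_transpose (H * G.transpose), Matrix.transpose_mul,
      Matrix.transpose_transpose, hGH, Matrix.transpose_zero]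
  rw [Matrix.mulVecLin_apply, Matrix.mulVec_mulVec, h, Matrix.zero_mulVec]

theorem mulVec_eq_of_add_mem_rowSpace {m k n : ℕ} {H : Matrix (Fin m) (Fin n) (ZMod 2)}
    {G : Matrix (Fin k) (Fin n) (ZMod 2)} (hGH : G * H.transpose = 0) {x y : BitVect n}
    (h : x + y ∈ rowSpace G) : H.mulVec x = H.mulVec y := by
  have h1 := mulVec_eq_zero_of_mem_rowSpace hGH h
  rw [Matrix.mulVec_add] at h1
  rw [← bitVect_add_cancel (H.mulVec x) (H.mulVec y), h1, add_zero]

/-- Below the confinement scale, a vector of the kernel of `H` is trivial. -/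
theorem Confined.mem_rowSpace {m k n : ℕ} {H : Matrix (Fin m) (Fin n) (ZMod 2)}
    {G : Matrix (Fin k) (Fin n) (ZMod 2)} {d γ : ℝ} (hc : Confined H G d γ) (hγ : 0 < γ)
    {x : BitVect n} (hx : (hammingNorm x : ℝ) ≤ d) (hHx : H.mulVec x = 0) :
    x ∈ rowSpace G := by
  have hle : (reducedWeight G x : ℝ) ≤ hammingNorm x := by
    exact_mod_cast reducedWeight_le G x
  have h1 := hc x (hle.trans hx)
  rw [hHx, hammingNorm_zero, Nat.cast_zero] at h1
  have h2 : (reducedWeight G x : ℝ) ≤ 0 := by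
    by_contra hneg
    push Not at hneg
    exact absurd h1 (not_le.2 (mul_pos hγ hneg))
  have h3 : reducedWeight G x = 0 := by exact_mod_cast le_antisymm h2 (Nat.cast_nonneg _)
  obtain ⟨a, ha, hw⟩ := exists_reducedWeight_eq G x
  rw [h3] at hw
  have h4 : x + a = 0 := hammingNorm_eq_zero.1 hw.symm
  have h5 := bitVect_add_cancel x a
  rw [h4, add_zero] at h5
  rwa [h5]

/-! ### Connected half-subsets -/

/-- `maxConn` is defined with the classical decidability of equality; this passes to any other
instance. -/
theorem isAlphaSubset_iff {V : Type*} {i₁ i₂ : DecidableEq V} {α : ℝ} {A B : Finset V} :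
    @IsAlphaSubset V i₁ α A B ↔
      α * B.card ≤ (@Inter.inter _ (@Finset.instInter V i₂) A B).card := by
  rw [Subsingleton.elim i₁ i₂]
  rfl

theorem card_le_maxConn {V : Type*} [Fintype V] [DecidableEq V] {Γ : SimpleGraph V} {α : ℝ}
    {A B : Finset V} (hB : (Γ.induce (B : Set V)).Connected) (hAB : α * B.card ≤ (A ∩ B).card) :
    B.card ≤ maxConn Γ α A := by
  unfold maxConn
  apply Finset.le_sup (f := Finset.card)
  simp only [Finset.mem_filter]
  exact ⟨Finset.mem_univ _, hB, isAlphaSubset_iff.2 hAB⟩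

theorem exists_of_lt_maxConn {V : Type*} [Fintype V] [DecidableEq V] {Γ : SimpleGraph V} {α : ℝ}
    {A : Finset V} {t : ℝ} (ht : 0 ≤ t) (h : t < maxConn Γ α A) :
    ∃ B : Finset V, (Γ.induce (B : Set V)).Connected ∧ α * B.card ≤ (A ∩ B).card ∧ t < B.card := by
  by_contra! hcon
  refine absurd h (not_lt.2 ?_)
  rw [← Nat.le_floor_iff ht]
  unfold maxConn
  refine Finset.sup_le fun B hB => ?_
  simp only [Finset.mem_filter] at hB
  exact Nat.le_floor (hcon B hB.2.1 (isAlphaSubset_iff.1 hB.2.2))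

theorem maxConn_mono {V : Type*} [Fintype V] {Γ : SimpleGraph V} {α : ℝ}
    {A A' : Finset V} (h : A ⊆ A') : maxConn Γ α A ≤ maxConn Γ α A' := by
  classical
  refine Finset.sup_mono fun B hB => ?_
  obtain ⟨-, hBc, hBA⟩ := Finset.mem_filter.1 hB
  refine Finset.mem_filter.2 ⟨Finset.mem_univ _, hBc, hBA.trans ?_⟩
  exact_mod_cast Finset.card_le_card (Finset.inter_subset_inter_right h)

theorem maxConn_empty {V : Type*} [Fintype V] (Γ : SimpleGraph V) {α : ℝ} (hα : 0 < α) :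
    maxConn Γ α ∅ = 0 := by
  classical
  refine Nat.le_zero.1 (Finset.sup_le fun B hB => ?_)
  obtain ⟨-, hBc, hBA⟩ := Finset.mem_filter.1 hB
  unfold IsAlphaSubset at hBA
  rw [Finset.empty_inter, Finset.card_empty, Nat.cast_zero] at hBA
  have : (B.card : ℝ) ≤ 0 := by
    by_contra hneg
    push Not at hneg
    exact absurd hBA (not_le.2 (mul_pos hα hneg))
  exact_mod_cast this

/-! ### Energy of a tame vector with a small perturbation -/

/-- A reduced vector `r` without connected half-subset larger than `d / 2`, together with a
perturbation `y` of weight less than `d / 4`. -/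
structure IsTame {m k n : ℕ} (H : Matrix (Fin m) (Fin n) (ZMod 2))
    (G : Matrix (Fin k) (Fin n) (ZMod 2)) (d : ℝ) (r y : BitVect n) : Prop where
  reduced : IsReducedVec G r
  conn : (maxConn (bitGraph H) (1 / 2) (bitSupport r) : ℝ) ≤ d / 2
  small : (hammingNorm y : ℝ) < d / 4

theorem IsTame.restriction {m k n : ℕ} {H : Matrix (Fin m) (Fin n) (ZMod 2)}
    {G : Matrix (Fin k) (Fin n) (ZMod 2)} {d : ℝ} {r y : BitVect n} (h : IsTame H G d r y)
    (U : Finset (Fin n)) : IsTame H G d (restr U r) (restr U y) where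
  reduced := h.reduced.restriction U
  conn := le_trans (by exact_mod_cast maxConn_mono (bitSupport_restr_subset U r)) h.conn
  small := lt_of_le_of_lt (by exact_mod_cast hammingNorm_restr_le U y) h.small

/-- A connected set with more than `d / 2` bits contains more bits outside of a tame vector than
inside. -/
theorem IsTame.lt_of_connected {m k n : ℕ} {H : Matrix (Fin m) (Fin n) (ZMod 2)}
    {G : Matrix (Fin k) (Fin n) (ZMod 2)} {d : ℝ} {r y : BitVect n} (h : IsTame H G d r y)
    {B : Finset (Fin n)} (hB : ((bitGraph H).induce (B : Set (Fin n))).Connected)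
    (hcard : d / 2 < B.card) : (hammingNorm (restr B r) : ℝ) < B.card / 2 := by
  by_contra hneg
  push Not at hneg
  rw [hammingNorm_restr] at hneg
  have h1 : B.card ≤ maxConn (bitGraph H) (1 / 2) (bitSupport r) :=
    card_le_maxConn hB (by linarith)
  have h2 : (B.card : ℝ) ≤ maxConn (bitGraph H) (1 / 2) (bitSupport r) := by exact_mod_cast h1
  linarith [h.conn]

theorem coe_block_singleton {n : ℕ} {ι : Type*} (p : Fin n → ι) (c : ι) :
    ((block p {c} : Finset (Fin n)) : Set (Fin n)) = {v | p v = c} := by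
  ext v
  simp [mem_block]

theorem connected_induce_block_cluster {n : ℕ} (Γ : SimpleGraph (Fin n)) (A : Finset (Fin n))
    (c : (clusterGraph Γ A).ConnectedComponent) :
    (Γ.induce ((block (cluster Γ A) {c} : Finset (Fin n)) : Set (Fin n))).Connected := by
  rw [coe_block_singleton]
  exact connected_induce_cluster c

/-- A cluster of `A` either lies inside `A` or avoids it. -/
theorem block_cluster_subset_or_disjoint {n : ℕ} (Γ : SimpleGraph (Fin n)) (A : Finset (Fin n))
    (c : (clusterGraph Γ A).ConnectedComponent) :
    block (cluster Γ A) {c} ⊆ A ∨ Disjoint A (block (cluster Γ A) {c}) := by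
  by_cases h : Disjoint A (block (cluster Γ A) {c})
  · exact Or.inr h
  · obtain ⟨a, ha, hac⟩ := Finset.not_disjoint_iff.1 h
    refine Or.inl fun b hb => ?_
    rw [mem_block, Finset.mem_singleton] at hac hb
    rcases eq_or_mem_of_cluster_eq (hac.trans hb.symm) with rfl | h2
    · exact ha
    · exact h2.2

theorem restr_eq_zero_of_disjoint {n : ℕ} {x : BitVect n} {A U : Finset (Fin n)}
    (hx : bitSupport x ⊆ A) (h : Disjoint A U) : restr U x = 0 := by
  funext j
  by_cases hj : j ∈ U
  · have : j ∉ bitSupport x := fun hjx => Finset.disjoint_left.1 h (hx hjx) hj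
    rw [mem_bitSupport, not_not] at this
    simp [restr, this]
  · simp [restr, hj]

theorem sum_block_univ {n : ℕ} {ι : Type*} [Fintype ι] (p : Fin n → ι) (x : BitVect n) :
    ∑ c, hammingNorm (restr (block p {c}) x) = hammingNorm x := by
  rw [sum_hammingNorm_restr_block, restr_block_univ]

/-- The perturbation is too small to connect clusters of a tame vector to something of more than
`d / 2` bits, so that confinement applies to each cluster of the perturbed vector. -/
theorem IsTame.energy_ge {m k n : ℕ} {H : Matrix (Fin m) (Fin n) (ZMod 2)}
    {G : Matrix (Fin k) (Fin n) (ZMod 2)} {d γ : ℝ} {r y : BitVect n} (h : IsTame H G d r y)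
    (hc : Confined H G d γ) (hγ : 0 < γ) :
    γ * ((hammingNorm r : ℝ) - hammingNorm y) ≤ hammingNorm (H.mulVec (r + y)) := by
  classical
  set A := bitSupport r ∪ bitSupport y with hA
  set p := cluster (bitGraph H) A with hp
  have hrA : bitSupport r ⊆ A := Finset.subset_union_left
  have hyA : bitSupport y ⊆ A := Finset.subset_union_right
  have hzA : bitSupport (r + y) ⊆ A := bitSupport_add_subset r y
  have hd : 0 < d := by
    have := h.small
    have h0 : (0 : ℝ) ≤ hammingNorm y := Nat.cast_nonneg _
    linarith
  have hsplit := (Separates.of_cluster (H := H) hzA).hammingNorm_mulVec_restr Finset.univ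
  rw [restr_block_univ] at hsplit
  rw [hsplit, ← sum_block_univ p r, ← sum_block_univ p y]
  push_cast
  rw [← Finset.sum_sub_distrib, Finset.mul_sum]
  refine Finset.sum_le_sum fun c _ => ?_
  rcases block_cluster_subset_or_disjoint (bitGraph H) A c with hsub | hdisj
  · set B := block p {c} with hB
    have hconn : ((bitGraph H).induce (B : Set (Fin n))).Connected :=
      connected_induce_block_cluster _ _ c
    have hBcard : (B.card : ℝ) ≤ hammingNorm (restr B r) + hammingNorm y := by
      have h1 : B ⊆ (bitSupport r ∩ B) ∪ bitSupport y := by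
        intro j hj
        have := hsub hj
        simp only [hA, Finset.mem_union, Finset.mem_inter] at this ⊢
        tauto
      have h2 := (Finset.card_le_card h1).trans (Finset.card_union_le _ _)
      rw [hammingNorm_restr, ← card_bitSupport y]
      exact_mod_cast h2
    have hBd : (B.card : ℝ) ≤ d / 2 := by
      by_contra hneg
      push Not at hneg
      have := h.lt_of_connected hconn hneg
      linarith [h.small]
    have hle : (reducedWeight G (restr B (r + y)) : ℝ) ≤ d := by
      have h1 : (reducedWeight G (restr B (r + y)) : ℝ) ≤ B.card := by
        exact_mod_cast (reducedWeight_le G _).trans (hammingNorm_restr_le_card B _)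
      linarith
    refine le_trans (mul_le_mul_of_nonneg_left ?_ hγ.le) (hc _ hle)
    have h3 := (h.reduced.restriction B).le_reducedWeight_add (restr B y)
    rw [← restr_add] at h3
    have h4 : (hammingNorm (restr B r) : ℝ) ≤
      reducedWeight G (restr B (r + y)) + hammingNorm (restr B y) := by
        exact_mod_cast h3
    linarith
  · have h1 := restr_eq_zero_of_disjoint hrA hdisj
    have h2 := restr_eq_zero_of_disjoint hyA hdisj
    rw [h1, h2]
    simp

/-! ### Removing a large connected piece -/

section Removal

variable {m k n : ℕ} {H : Matrix (Fin m) (Fin n) (ZMod 2)} {G : Matrix (Fin k) (Fin n) (ZMod 2)}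
  {d γ : ℝ} {s r y : BitVect n}

/-- The clusters used to compare two representatives `s` and `r + y` of the same class. -/
abbrev jointSupport (s r y : BitVect n) : Finset (Fin n) :=
  bitSupport s ∪ (bitSupport r ∪ bitSupport y)

theorem separates_second : Separates H (cluster (bitGraph H) (jointSupport s r y)) (r + y) :=
  Separates.of_cluster ((bitSupport_add_subset r y).trans Finset.subset_union_right)

/-- Vectors of the same class have the same syndrome on every joint cluster. -/
theorem mulVec_restr_block_eq (hGH : G * H.transpose = 0) (hcls : s + (r + y) ∈ rowSpace G)
    (S : Finset (clusterGraph (bitGraph H) (jointSupport s r y)).ConnectedComponent) :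
    H.mulVec (restr (block (cluster (bitGraph H) (jointSupport s r y)) S) s) =
      H.mulVec (restr (block (cluster (bitGraph H) (jointSupport s r y)) S) (r + y)) := by
  have hsep : Separates H (cluster (bitGraph H) (jointSupport s r y)) (s + (r + y)) :=
    Separates.of_cluster ((bitSupport_add_subset _ _).trans
      (Finset.union_subset_union_right (bitSupport_add_subset r y)))
  have h0 := mulVec_eq_zero_of_mem_rowSpace hGH hcls
  have h1 : H.mulVec (restr (block (cluster (bitGraph H) (jointSupport s r y)) S)
      (s + (r + y))) = 0 := by
    funext i
    rcases hsep.mulVec_restr_apply i with h | ⟨c, h⟩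
    · exact h S
    · rw [h, h0]
      simp
  rw [restr_add, Matrix.mulVec_add] at h1
  rw [← bitVect_add_cancel
    (H.mulVec (restr (block (cluster (bitGraph H) (jointSupport s r y)) S) s))
    (H.mulVec (restr (block (cluster (bitGraph H) (jointSupport s r y)) S) (r + y))), h1, add_zero]

/-- On each joint cluster the tame vector is not heavier than the other reduced representative, up
to the perturbation. On a small cluster both restrictions lie in the same class by confinement; a
large one has less than half of its bits in the tame vector. -/
theorem IsTame.tame_weight_cluster_le (h : IsTame H G d r y) (hc : Confined H G d γ) (hγ : 0 < γ)
    (hGH : G * H.transpose = 0) (hcls : s + (r + y) ∈ rowSpace G)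
    (c : (clusterGraph (bitGraph H) (jointSupport s r y)).ConnectedComponent) :
    hammingNorm (restr (block (cluster (bitGraph H) (jointSupport s r y)) {c}) r) ≤
      hammingNorm (restr (block (cluster (bitGraph H) (jointSupport s r y)) {c}) s) +
      hammingNorm (restr (block (cluster (bitGraph H) (jointSupport s r y)) {c}) y) := by
  classical
  have hd : 0 < d := by
    have := h.small
    have h0 : (0 : ℝ) ≤ hammingNorm y := Nat.cast_nonneg _
    linarith
  have hconn := connected_induce_block_cluster (bitGraph H) (jointSupport s r y) c
  have hker := mulVec_restr_block_eq hGH hcls {c}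
  rcases block_cluster_subset_or_disjoint (bitGraph H) (jointSupport s r y) c with hsub | hdisj
  · set B := block (cluster (bitGraph H) (jointSupport s r y)) {c} with hB
    by_cases hBd : (B.card : ℝ) ≤ d / 2
    · have hmem : restr B (s + (r + y)) ∈ rowSpace G := by
        refine hc.mem_rowSpace hγ ?_ ?_
        · have : (hammingNorm (restr B (s + (r + y))) : ℝ) ≤ B.card := by
            exact_mod_cast hammingNorm_restr_le_card B _
          linarith
        · rw [restr_add, Matrix.mulVec_add, hker, bitVect_add_self]
      have h1 := h.reduced.restriction B _ hmem
      have h2 : restr B r + restr B (s + (r + y)) =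
          restr B s + restr B y := by
        rw [restr_add, restr_add]
        calc _ = restr B r + restr B r +
              (restr B s + restr B y) := by abel
          _ = _ := by rw [bitVect_add_self, zero_add]
      rw [h2] at h1
      exact h1.trans (hammingNorm_add_le _ _)
    · push Not at hBd
      have h1 := h.lt_of_connected hconn hBd
      have h2 : B ⊆ (bitSupport s ∩ B) ∪ ((bitSupport r ∩ B) ∪ (bitSupport y ∩ B)) := by
        intro j hj
        have := hsub hj
        simp only [jointSupport, Finset.mem_union, Finset.mem_inter] at this ⊢
        tauto
      have h3 := (Finset.card_le_card h2).trans ((Finset.card_union_le _ _).trans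
        (Nat.add_le_add_left (Finset.card_union_le _ _) _))
      rw [← hammingNorm_restr, ← hammingNorm_restr, ← hammingNorm_restr] at h3
      have h4 : 2 * hammingNorm (restr B r) < B.card := by
        have : 2 * (hammingNorm (restr B r) : ℝ) < B.card := by linarith
        exact_mod_cast this
      omega
  · have h1 := restr_eq_zero_of_disjoint
      (Finset.subset_union_left.trans Finset.subset_union_right) hdisj (x := r)
    rw [h1, hammingNorm_zero]
    exact Nat.zero_le _

/-- Since both representatives have almost the same weight in total, a cluster cannot carry much
more of the one than of the other. -/
theorem IsTame.weight_cluster_le_tame (h : IsTame H G d r y) (hs : IsReducedVec G s)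
    (hc : Confined H G d γ) (hγ : 0 < γ)
    (hGH : G * H.transpose = 0) (hcls : s + (r + y) ∈ rowSpace G)
    (c : (clusterGraph (bitGraph H) (jointSupport s r y)).ConnectedComponent) :
    hammingNorm (restr (block (cluster (bitGraph H) (jointSupport s r y)) {c}) s) +
      hammingNorm (restr (block (cluster (bitGraph H) (jointSupport s r y)) {c}) y) ≤
      hammingNorm (restr (block (cluster (bitGraph H) (jointSupport s r y)) {c}) r) +
        2 * hammingNorm y := by
  classical
  set p := cluster (bitGraph H) (jointSupport s r y) with hp
  have htot : hammingNorm s ≤ hammingNorm r + hammingNorm y := by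
    have := hs _ hcls
    rw [bitVect_add_cancel] at this
    exact this.trans (hammingNorm_add_le r y)
  rw [← sum_block_univ p s, ← sum_block_univ p r] at htot
  have hy := sum_block_univ p y
  rw [← Finset.add_sum_erase _ _ (Finset.mem_univ c)] at htot hy
  rw [← Finset.add_sum_erase _ (fun c => hammingNorm (restr (block p {c}) r))
    (Finset.mem_univ c)] at htot
  have hother : ∑ c' ∈ Finset.univ.erase c, hammingNorm (restr (block p {c'}) r) ≤
      ∑ c' ∈ Finset.univ.erase c, hammingNorm (restr (block p {c'}) s) +
      ∑ c' ∈ Finset.univ.erase c, hammingNorm (restr (block p {c'}) y) := by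
    rw [← Finset.sum_add_distrib]
    exact Finset.sum_le_sum fun c' _ => h.tame_weight_cluster_le hc hγ hGH hcls c'
  omega

/-- The energy of every joint cluster is proportional to the weight in it of the reduced
representative `s`, even if that weight exceeds the confinement scale. -/
theorem IsTame.cluster_energy_ge (h : IsTame H G d r y) (hs : IsReducedVec G s)
    (hc : Confined H G d γ) (hγ : 0 < γ)
    (hGH : G * H.transpose = 0) (hcls : s + (r + y) ∈ rowSpace G)
    (c : (clusterGraph (bitGraph H) (jointSupport s r y)).ConnectedComponent) :
    γ / 2 * hammingNorm
        (restr (block (cluster (bitGraph H) (jointSupport s r y)) {c}) s) ≤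
      hammingNorm (H.mulVec
        (restr (block (cluster (bitGraph H) (jointSupport s r y)) {c}) (r + y))) := by
  have hker := mulVec_restr_block_eq hGH hcls {c}
  have hle := h.weight_cluster_le_tame hs hc hγ hGH hcls c
  set B := block (cluster (bitGraph H) (jointSupport s r y)) {c} with hB
  have hpos : (0 : ℝ) ≤ hammingNorm (restr B s) := Nat.cast_nonneg _
  -- Above the confinement scale, `2 |y| < d / 2` is less than half of the weight of `s` in `B`.
  by_cases hd : (hammingNorm (restr B s) : ℝ) ≤ d
  · have h1 := hc (restr B s)
    rw [(hs.restriction B).reducedWeight_eq, hker] at h1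
    nlinarith [h1 hd, mul_nonneg hγ.le hpos]
  · push Not at hd
    have h1 := (h.restriction B).energy_ge hc hγ
    rw [← restr_add] at h1
    refine le_trans ?_ h1
    have h2 : (hammingNorm (restr B s) : ℝ) + hammingNorm (restr B y) ≤
        hammingNorm (restr B r) + 2 * hammingNorm y := by exact_mod_cast hle
    have h3 := h.small
    have h4 : (hammingNorm (restr B y) : ℝ) ≤ hammingNorm y := by
      exact_mod_cast hammingNorm_restr_le B y
    nlinarith [mul_nonneg hγ.le hpos]

end Removal

section Piece

variable {m k n : ℕ} {H : Matrix (Fin m) (Fin n) (ZMod 2)} {G : Matrix (Fin k) (Fin n) (ZMod 2)}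
  {d γ : ℝ} {s r y : BitVect n}

/-- If a reduced vector `s` with a connected half-subset larger than `d / 2` is equivalent to a
tame vector plus a small perturbation, then some connected set `U` of more than `d / 2` bits
carries a separated piece of `r + y` with energy proportional to `|U|`. -/
theorem IsTame.exists_removable_piece (h : IsTame H G d r y) (hs : IsReducedVec G s)
    (hc : Confined H G d γ) (hγ : 0 < γ) (hGH : G * H.transpose = 0)
    (hcls : s + (r + y) ∈ rowSpace G)
    (hbig : d / 2 < maxConn (bitGraph H) (1 / 2) (bitSupport s)) :
    ∃ U ∈ connectedSets (bitGraph H) (d / 2),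
      γ / 11 * U.card ≤ hammingNorm (H.mulVec (restr U (r + y))) ∧
      ∀ σ : BitVect m, hammingNorm (σ + H.mulVec (r + y + restr U (r + y))) +
          hammingNorm (H.mulVec (restr U (r + y))) ≤
        hammingNorm (σ + H.mulVec (r + y)) +
          2 * (bitSupport σ ∩ bitSupport (H.mulVec (restr U (r + y)))).card := by
  classical
  have hd : 0 < d := by
    have := h.small
    have h0 : (0 : ℝ) ≤ hammingNorm y := Nat.cast_nonneg _
    linarith
  obtain ⟨B, hBconn, hBhalf, hBcard⟩ := exists_of_lt_maxConn (by linarith) hbig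
  set p := cluster (bitGraph H) (jointSupport s r y) with hp
  set U := block p (B.image p) with hU
  have hsep : Separates H p (r + y) := separates_second
  have hUcoe : (U : Set (Fin n)) = {v | ∃ b ∈ (B : Set (Fin n)), p v = p b} := by
    ext v
    simp only [hU, Finset.mem_coe, mem_block, Finset.mem_image, Set.mem_ofPred_eq]
    exact exists_congr fun b => and_congr_right fun _ => eq_comm
  have hUconn : ((bitGraph H).induce (U : Set (Fin n))).Connected := by
    rw [hUcoe]
    exact connected_induce_cluster_hull hBconn
  have hBU : B ⊆ U := fun b hb => mem_block.2 (Finset.mem_image_of_mem p hb)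
  have hBUcard : (B.card : ℝ) ≤ U.card := by exact_mod_cast Finset.card_le_card hBU
  refine ⟨U, ?_, ?_, fun σ => hsep.energy_drop (B.image p) σ⟩
  · simp only [connectedSets, Finset.mem_filter]
    exact ⟨Finset.mem_univ _, hUconn, hBcard.trans_le hBUcard⟩
  have henergy₁ : γ / 2 * hammingNorm (restr U s) ≤
      hammingNorm (H.mulVec (restr U (r + y))) := by
    rw [hU, hsep.hammingNorm_mulVec_restr, ← sum_hammingNorm_restr_block]
    push_cast
    rw [Finset.mul_sum]
    exact Finset.sum_le_sum fun c _ => h.cluster_energy_ge hs hc hγ hGH hcls c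
  have henergy₂ := (h.restriction U).energy_ge hc hγ
  rw [← restr_add] at henergy₂
  have hsB : (B.card : ℝ) / 2 ≤ hammingNorm (restr U s) := by
    have : (bitSupport s ∩ B).card ≤ hammingNorm (restr U s) := by
      rw [hammingNorm_restr]
      exact Finset.card_le_card (Finset.inter_subset_inter_left hBU)
    have h' : ((bitSupport s ∩ B).card : ℝ) ≤ hammingNorm (restr U s) := by
      exact_mod_cast this
    linarith
  -- A bit of `U` outside the joint support is its own cluster, hence a bit of `B`.
  have hUsub : U ⊆ B ∪ ((bitSupport s ∩ U) ∪ ((bitSupport r ∩ U) ∪ (bitSupport y ∩ U))) := by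
    intro j hj
    obtain ⟨b, hb, hbj⟩ := Finset.mem_image.1 (mem_block.1 hj)
    rcases eq_or_mem_of_cluster_eq hbj with rfl | ⟨-, hjA⟩
    · exact Finset.mem_union_left _ hb
    · simp only [jointSupport, Finset.mem_union, Finset.mem_inter] at hjA ⊢
      tauto
  have hUcard : (U.card : ℝ) ≤ B.card + (hammingNorm (restr U s) +
      (hammingNorm (restr U r) + hammingNorm (restr U y))) := by
    have := (Finset.card_le_card hUsub).trans ((Finset.card_union_le _ _).trans
      (Nat.add_le_add_left ((Finset.card_union_le _ _).trans
        (Nat.add_le_add_left (Finset.card_union_le _ _) _)) _))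
    simp only [← hammingNorm_restr] at this
    exact_mod_cast this
  have hysmall := (h.restriction U).small
  set E : ℝ := (hammingNorm (H.mulVec (restr U (r + y))) : ℝ)
  -- As `2 |y| < d / 2 < |B|` and `|B| ≤ 2 |s|` on `U`, the size of `U` is at most five times
  -- the weight of `s` on it plus `|r| - |y|`, and both terms are bounded by the energy.
  have h1 : (U.card : ℝ) ≤ 5 * hammingNorm (restr U s) +
      ((hammingNorm (restr U r) : ℝ) - hammingNorm (restr U y)) := by linarith
  calc γ / 11 * U.card ≤ γ / 11 * (5 * hammingNorm (restr U s) +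
      ((hammingNorm (restr U r) : ℝ) - hammingNorm (restr U y))) := by gcongr
    _ = 1 / 11 * (10 * (γ / 2 * hammingNorm (restr U s)) +
      γ * ((hammingNorm (restr U r) : ℝ) - hammingNorm (restr U y))) := by ring
    _ ≤ 1 / 11 * (10 * E + E) := by gcongr
    _ = E := by ring

end Piece

/-! ### The Peierls argument -/

/-- Peierls bound: if each configuration of `S` can be moved into `X` by one of the shifts `u i` at
the price of a factor `a i`, then the weight of `S` is at most `∑ a i` times that of `X`. -/
theorem sum_indicator_le_of_shifts {n : ℕ} {ι : Type*} (I : Finset ι) (u : ι → BitVect n)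
    (a : ι → ℝ) (ha : ∀ i, 0 ≤ a i) (f : BitVect n → ℝ) (hf : ∀ x, 0 ≤ f x)
    (S X : Set (BitVect n))
    (hshift : ∀ w ∈ S, ∃ i ∈ I, w + u i ∈ X ∧ f w ≤ a i * f (w + u i)) :
    ∑ w, S.indicator f w ≤ (∑ i ∈ I, a i) * ∑ w, X.indicator f w := by
  have hX : ∀ w, 0 ≤ X.indicator f w := fun w => Set.indicator_nonneg (fun x _ => hf x) w
  calc ∑ w, S.indicator f w ≤ ∑ w, ∑ i ∈ I, a i * X.indicator f (w + u i) := by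
        refine Finset.sum_le_sum fun w _ => ?_
        by_cases hw : w ∈ S
        · obtain ⟨i, hi, hiX, hle⟩ := hshift w hw
          rw [Set.indicator_of_mem hw]
          refine le_trans ?_ (Finset.single_le_sum
            (f := fun i => a i * X.indicator f (w + u i))
            (fun j _ => mul_nonneg (ha j) (hX _)) hi)
          rwa [Set.indicator_of_mem hiX]
        · rw [Set.indicator_of_notMem hw]
          exact Finset.sum_nonneg fun j _ => mul_nonneg (ha j) (hX _)
    _ = ∑ i ∈ I, a i * ∑ w, X.indicator f w := by
        rw [Finset.sum_comm]
        refine Finset.sum_congr rfl fun i _ => ?_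
        rw [← Finset.mul_sum]
        congr 1
        exact Equiv.sum_comp (Equiv.addRight (u i)) (X.indicator f)
    _ = (∑ i ∈ I, a i) * ∑ w, X.indicator f w := by rw [Finset.sum_mul]

theorem boltzmann_pos {m n : ℕ} (β : ℝ) (H : Matrix (Fin m) (Fin n) (ZMod 2)) (x : BitVect n) :
    0 < boltzmann β H x := Real.exp_pos _

/-- The vector with support `D`. -/
def ofSupport {n : ℕ} (D : Finset (Fin n)) : BitVect n := fun j => if j ∈ D then 1 else 0

theorem ofSupport_bitSupport {n : ℕ} (x : BitVect n) : ofSupport (bitSupport x) = x := by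
  have htwo : ∀ t : ZMod 2, t = 0 ∨ t = 1 := by decide
  funext j
  rcases htwo (x j) with h | h <;> simp [ofSupport, mem_bitSupport, h]

open Classical in
/-- The checks that see a bit of `U`. -/
noncomputable def checkNbhd {m n : ℕ} (H : Matrix (Fin m) (Fin n) (ZMod 2))
    (U : Finset (Fin n)) : Finset (Fin m) :=
  Finset.univ.filter fun i => ∃ j ∈ U, H i j ≠ 0

theorem card_checkNbhd_le {m n : ℕ} {H : Matrix (Fin m) (Fin n) (ZMod 2)} {wBit : ℕ}
    (hw : ∀ j, hammingNorm (fun a => H a j) ≤ wBit) (U : Finset (Fin n)) :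
    (checkNbhd H U).card ≤ wBit * U.card := by
  classical
  have hsub : checkNbhd H U ⊆ U.biUnion fun j => bitSupport fun a => H a j := by
    intro i hi
    simp only [checkNbhd, Finset.mem_filter] at hi
    obtain ⟨-, j, hj, hij⟩ := hi
    exact Finset.mem_biUnion.2 ⟨j, hj, mem_bitSupport.2 hij⟩
  calc (checkNbhd H U).card ≤ _ := Finset.card_le_card hsub
    _ ≤ U.card * wBit := Finset.card_biUnion_le_card_mul _ _ _ fun j _ => hw j
    _ = wBit * U.card := mul_comm _ _

theorem bitSupport_mulVec_restr_subset {m n : ℕ} (H : Matrix (Fin m) (Fin n) (ZMod 2))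
    (U : Finset (Fin n)) (x : BitVect n) :
    bitSupport (H.mulVec (restr U x)) ⊆ checkNbhd H U := by
  intro i hi
  rw [mem_bitSupport] at hi
  simp only [Matrix.mulVec, dotProduct] at hi
  obtain ⟨j, -, hj⟩ := Finset.exists_ne_zero_of_sum_ne_zero hi
  simp only [checkNbhd, Finset.mem_filter]
  refine ⟨Finset.mem_univ _, j, ?_, left_ne_zero_of_mul hj⟩
  by_contra hjU
  exact right_ne_zero_of_mul hj (by simp [restr, hjU])

open Classical in
theorem card_adj_bitGraph_le {m n : ℕ} {H : Matrix (Fin m) (Fin n) (ZMod 2)} {wCheck wBit : ℕ}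
    (hc : ∀ a, hammingNorm (fun j => H a j) ≤ wCheck)
    (hb : ∀ j, hammingNorm (fun a => H a j) ≤ wBit) (v : Fin n) :
    (Finset.univ.filter fun w => (bitGraph H).Adj v w).card ≤ wBit * wCheck := by
  have hsub : (Finset.univ.filter fun w => (bitGraph H).Adj v w) ⊆
      (bitSupport fun a => H a v).biUnion fun a => bitSupport fun j => H a j := by
    intro w hw
    obtain ⟨-, -, i, hiv, hiw⟩ := Finset.mem_filter.1 hw
    exact Finset.mem_biUnion.2 ⟨i, mem_bitSupport.2 hiv, mem_bitSupport.2 hiw⟩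
  calc _ ≤ _ := Finset.card_le_card hsub
    _ ≤ (bitSupport fun a => H a v).card * wCheck :=
        Finset.card_biUnion_le_card_mul _ _ _ fun a _ => hc a
    _ ≤ wBit * wCheck := Nat.mul_le_mul_right _ (hb v)

theorem mulVec_surjective_of_rank {m n : ℕ} {H : Matrix (Fin m) (Fin n) (ZMod 2)}
    (hr : H.rank = m) : Function.Surjective H.mulVec := by
  have : LinearMap.range H.mulVecLin = ⊤ := by
    refine Submodule.eq_top_of_finrank_eq ?_
    rw [← Matrix.rank, hr]
    simp
  exact LinearMap.range_eq_top.1 this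

/-! ### Typical syndromes -/

/-- The syndrome `σ` violates at most `ε |U|` checks next to any connected set `U` of more than
`t` bits. -/
def IsTypical {m n : ℕ} (H : Matrix (Fin m) (Fin n) (ZMod 2)) (ε t : ℝ) (σ : BitVect m) : Prop :=
  ∀ U ∈ connectedSets (bitGraph H) t, ((bitSupport σ ∩ checkNbhd H U).card : ℝ) ≤ ε * U.card

theorem two_pow_eq_exp (a : ℕ) : (2 : ℝ) ^ a = Real.exp (Real.log 2 * a) := by
  rw [mul_comm, Real.exp_nat_mul, Real.exp_log (by norm_num)]

/-- Atypical syndromes are unlikely. As `H` has full rank, any prescribed set `T` of violated checks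
can be repaired by one shift of the configuration, which gains a factor `exp (β |T|)`. -/
theorem gibbs_atypical_le {m n : ℕ} {H : Matrix (Fin m) (Fin n) (ZMod 2)} (hr : H.rank = m)
    {wBit : ℕ} (hb : ∀ j, hammingNorm (fun a => H a j) ≤ wBit) {β ε t : ℝ} (hβ : 0 ≤ β) :
    gibbs β H {x₀ | ¬ IsTypical H ε t (H.mulVec x₀)} ≤
      ∑ U ∈ connectedSets (bitGraph H) t, Real.exp (-(β * ε - wBit * Real.log 2) * U.card) := by
  classical
  choose pre hpre using mulVec_surjective_of_rank hr
  have key := sum_indicator_le_of_shifts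
    ((connectedSets (bitGraph H) t).sigma fun U => (checkNbhd H U).powerset)
    (fun q => pre (ofSupport q.2)) (fun q => Real.exp (-β * (ε * q.1.card)))
    (fun _ => (Real.exp_pos _).le) (boltzmann β H) (fun x => (boltzmann_pos β H x).le)
    {x₀ | ¬ IsTypical H ε t (H.mulVec x₀)} Set.univ ?_
  · rw [Set.indicator_univ, Finset.sum_sigma] at key
    have hZ : 0 < ∑ x, boltzmann β H x :=
      Finset.sum_pos (fun x _ => boltzmann_pos β H x) ⟨0, Finset.mem_univ _⟩
    unfold gibbs
    rw [div_le_iff₀ hZ]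
    refine key.trans (mul_le_mul_of_nonneg_right (Finset.sum_le_sum fun U _ => ?_) hZ.le)
    simp only [Finset.sum_const, Finset.card_powerset, nsmul_eq_mul]
    push_cast
    calc (2 : ℝ) ^ (checkNbhd H U).card * Real.exp (-β * (ε * U.card))
        ≤ 2 ^ (wBit * U.card) * Real.exp (-β * (ε * U.card)) := by
          gcongr
          · norm_num
          · exact card_checkNbhd_le hb U
      _ = Real.exp (-(β * ε - wBit * Real.log 2) * U.card) := by
          rw [two_pow_eq_exp, ← Real.exp_add]
          congr 1
          push_cast
          ring
  · intro x hx
    simp only [Set.mem_ofPred_eq, IsTypical] at hx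
    push Not at hx
    obtain ⟨U, hU, hlt⟩ := hx
    set T := bitSupport (H.mulVec x) ∩ checkNbhd H U with hT
    refine ⟨⟨U, T⟩, Finset.mem_sigma.2 ⟨hU, Finset.mem_powerset.2 Finset.inter_subset_right⟩,
      Set.mem_univ _, ?_⟩
    have hTr : ofSupport T = restr (checkNbhd H U) (H.mulVec x) := by
      rw [← ofSupport_bitSupport (restr (checkNbhd H U) (H.mulVec x)), bitSupport_restr]
    have hnorm : hammingNorm (H.mulVec (x + pre (ofSupport T))) + T.card =
        hammingNorm (H.mulVec x) := by
      rw [Matrix.mulVec_add, hpre, hTr, add_restr,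
        ← hammingNorm_restr_add_compl (checkNbhd H U) (H.mulVec x), add_comm,
        hammingNorm_restr (checkNbhd H U)]
    have hnorm' : (hammingNorm (H.mulVec (x + pre (ofSupport T))) : ℝ) + T.card =
        hammingNorm (H.mulVec x) := by exact_mod_cast hnorm
    simp only [boltzmann]
    rw [← Real.exp_add, Real.exp_le_exp, ← hnorm']
    nlinarith [mul_le_mul_of_nonneg_left hlt.le hβ]

/-! ### The bottleneck -/

/-- The configurations whose difference to `x₀` is equivalent to a tame vector plus a small
perturbation. This neighbourhood of `Ω(x₀)` is invariant under the removal of pieces of the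
perturbed tame vector. -/
def tameNbhd {m k n : ℕ} (H : Matrix (Fin m) (Fin n) (ZMod 2))
    (G : Matrix (Fin k) (Fin n) (ZMod 2)) (d : ℝ) (x₀ : BitVect n) : Set (BitVect n) :=
  {w | ∃ r y, IsTame H G d r y ∧ x₀ + w + (r + y) ∈ rowSpace G}

section Bottleneck

variable {m k n : ℕ} {H : Matrix (Fin m) (Fin n) (ZMod 2)} {G : Matrix (Fin k) (Fin n) (ZMod 2)}
  {red : BitVect n → BitVect n} {d γ β : ℝ} {x₀ : BitVect n}

theorem mem_Omega_iff {w : BitVect n} : w ∈ Omega H red d x₀ ↔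
    (maxConn (bitGraph H) (1 / 2) (bitSupport (red (x₀ + w))) : ℝ) ≤ d / 2 := by
  constructor
  · rintro ⟨x, rfl, hx⟩
    rwa [bitVect_add_cancel]
  · intro h
    exact ⟨x₀ + w, (bitVect_add_cancel x₀ w).symm, h⟩

theorem Omega_subset_tameNbhd (hred : IsReduction G red) (hd : 0 < d) :
    Omega H red d x₀ ⊆ tameNbhd H G d x₀ := by
  intro w hw
  refine ⟨red (x₀ + w), 0, ⟨hred.isReducedVec _, mem_Omega_iff.1 hw, ?_⟩, ?_⟩
  · rw [hammingNorm_zero, Nat.cast_zero]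
    linarith
  · rw [add_zero]
    exact hred.mem _

theorem bdryOmega_subset_tameNbhd_diff (hred : IsReduction G red) :
    bdryOmega H red d x₀ ⊆ tameNbhd H G d x₀ \ Omega H red d x₀ := by
  rintro w ⟨hw, v, hv, hdist⟩
  refine ⟨⟨red (x₀ + v), w + v, ⟨hred.isReducedVec _, mem_Omega_iff.1 hv, ?_⟩, ?_⟩, hw⟩
  · have hneg : -w = w := neg_eq_of_add_eq_zero_left (bitVect_add_self w)
    rwa [hammingDist_eq_hammingNorm, hneg] at hdist
  · have : x₀ + w + (red (x₀ + v) + (w + v)) = x₀ + v + red (x₀ + v) := by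
      calc _ = w + w + (x₀ + v + red (x₀ + v)) := by abel
        _ = _ := by rw [bitVect_add_self, zero_add]
    rw [this]
    exact hred.mem _

/-- Peierls estimate around a configuration with typical syndrome: outside `Ω(x₀)` a large
connected piece of the fluctuation can be removed, which lowers the energy in proportion to its
size and does not leave the tame neighbourhood. -/
theorem sum_tameNbhd_diff_le (hred : IsReduction G red) (hc : Confined H G d γ) (hγ : 0 < γ)
    (hGH : G * H.transpose = 0) (hβ : 0 ≤ β)
    (htyp : IsTypical H (γ / 44) (d / 2) (H.mulVec x₀)) :
    ∑ w, (tameNbhd H G d x₀ \ Omega H red d x₀).indicator (boltzmann β H) w ≤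
      (∑ U ∈ connectedSets (bitGraph H) (d / 2),
        Real.exp (-(β * (γ / 22) - Real.log 2) * U.card)) *
        ∑ w, (tameNbhd H G d x₀).indicator (boltzmann β H) w := by
  classical
  have key := sum_indicator_le_of_shifts
    ((connectedSets (bitGraph H) (d / 2)).sigma fun U => U.powerset)
    (fun q => ofSupport q.2) (fun q => Real.exp (-β * (γ / 22 * q.1.card)))
    (fun _ => (Real.exp_pos _).le) (boltzmann β H) (fun x => (boltzmann_pos β H x).le)
    (tameNbhd H G d x₀ \ Omega H red d x₀) (tameNbhd H G d x₀) ?_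
  · rw [Finset.sum_sigma] at key
    convert key using 2
    refine Finset.sum_congr rfl fun U _ => ?_
    simp only [Finset.sum_const, Finset.card_powerset, nsmul_eq_mul]
    push_cast
    rw [two_pow_eq_exp, ← Real.exp_add]
    congr 1
    ring
  · rintro w ⟨⟨r, y, htame, hcls⟩, hw⟩
    rw [mem_Omega_iff, not_le] at hw
    have hcls' : red (x₀ + w) + (r + y) ∈ rowSpace G := by
      have h1 := Submodule.add_mem _ (hred.mem (x₀ + w)) hcls
      have h2 : x₀ + w + red (x₀ + w) + (x₀ + w + (r + y)) = red (x₀ + w) + (r + y) := by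
        calc _ = (x₀ + w) + (x₀ + w) + (red (x₀ + w) + (r + y)) := by abel
          _ = _ := by rw [bitVect_add_self, zero_add]
      rwa [h2] at h1
    obtain ⟨U, hU, henergy, hdrop⟩ := htame.exists_removable_piece (hred.isReducedVec _) hc hγ hGH
      hcls' hw
    set u := restr U (r + y) with hu
    refine ⟨⟨U, bitSupport u⟩, Finset.mem_sigma.2 ⟨hU, Finset.mem_powerset.2 ?_⟩, ?_, ?_⟩
    · rw [hu, bitSupport_restr]
      exact Finset.inter_subset_right
    · simp only [ofSupport_bitSupport]
      refine ⟨restr Uᶜ r, restr Uᶜ y, htame.restriction Uᶜ, ?_⟩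
      have h1 : x₀ + (w + u) + (restr Uᶜ r + restr Uᶜ y) = x₀ + w + (r + y) := by
        rw [← restr_add, hu]
        conv_rhs => rw [← restr_add_restr_compl U (r + y)]
        abel
      rwa [h1]
    · simp only [ofSupport_bitSupport]
      have hsyn : H.mulVec (x₀ + w) = H.mulVec (r + y) := mulVec_eq_of_add_mem_rowSpace hGH hcls
      have hHw : H.mulVec w = H.mulVec x₀ + H.mulVec (r + y) := by
        rw [← hsyn, Matrix.mulVec_add, bitVect_add_cancel]
      have hHwu : H.mulVec (w + u) = H.mulVec x₀ + H.mulVec (r + y + u) := by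
        rw [Matrix.mulVec_add, hHw, Matrix.mulVec_add H (r + y) u, add_assoc]
      have h1 := hdrop (H.mulVec x₀)
      rw [← hHw, ← hHwu] at h1
      have h2 : (bitSupport (H.mulVec x₀) ∩ bitSupport (H.mulVec u)).card ≤
          (bitSupport (H.mulVec x₀) ∩ checkNbhd H U).card :=
        Finset.card_le_card (Finset.inter_subset_inter_left
          (bitSupport_mulVec_restr_subset H U (r + y)))
      have h3 := htyp U hU
      have h4 : (hammingNorm (H.mulVec (w + u)) : ℝ) + hammingNorm (H.mulVec u) ≤
          hammingNorm (H.mulVec w) +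
            2 * (bitSupport (H.mulVec x₀) ∩ checkNbhd H U).card := by
        exact_mod_cast h1.trans (by omega)
      have h5 : γ / 22 * U.card + hammingNorm (H.mulVec (w + u)) ≤ hammingNorm (H.mulVec w) := by
        linarith
      simp only [boltzmann]
      rw [← Real.exp_add, Real.exp_le_exp]
      nlinarith [mul_le_mul_of_nonneg_left h5 hβ]

theorem Omega_weight_pos (hred : IsReduction G red) (hd : 0 ≤ d) :
    0 < ∑ w, (Omega H red d x₀).indicator (boltzmann β H) w := by
  refine Finset.sum_pos' (fun w _ => Set.indicator_nonneg (fun x _ => (boltzmann_pos β H x).le) w)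
    ⟨x₀, Finset.mem_univ _, ?_⟩
  have hmem : x₀ ∈ Omega H red d x₀ := by
    rw [mem_Omega_iff, bitVect_add_self]
    have h0 : red 0 = 0 := by
      rw [← hammingNorm_eq_zero, hred.weight]
      exact Nat.le_zero.1 ((reducedWeight_le G 0).trans_eq hammingNorm_zero)
    have h1 : bitSupport (0 : BitVect n) = ∅ := by
      ext j
      simp [mem_bitSupport]
    rw [h0, h1, maxConn_empty _ (by norm_num), Nat.cast_zero]
    linarith
  rw [Set.indicator_of_mem hmem]
  exact boltzmann_pos β H x₀

/-- If the Peierls factor `q` is at most `1 / 2`, the bottleneck ratio is at most `2 q`. -/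
theorem gibbs_bdryOmega_div_le (hred : IsReduction G red) (hd : 0 < d) {q : ℝ} (hq : q ≤ 1 / 2)
    (hpeierls : ∑ w, (tameNbhd H G d x₀ \ Omega H red d x₀).indicator (boltzmann β H) w ≤
      q * ∑ w, (tameNbhd H G d x₀).indicator (boltzmann β H) w) :
    gibbs β H (bdryOmega H red d x₀) / gibbs β H (Omega H red d x₀) ≤ 2 * q := by
  have hZ : 0 < ∑ x, boltzmann β H x :=
    Finset.sum_pos (fun x _ => boltzmann_pos β H x) ⟨0, Finset.mem_univ _⟩
  have hnn : ∀ x, 0 ≤ boltzmann β H x := fun x => (boltzmann_pos β H x).le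
  have hpos := Omega_weight_pos (H := H) (β := β) (x₀ := x₀) hred hd.le
  have hbdry : ∑ w, (bdryOmega H red d x₀).indicator (boltzmann β H) w ≤
      ∑ w, (tameNbhd H G d x₀ \ Omega H red d x₀).indicator (boltzmann β H) w :=
    Finset.sum_le_sum fun w _ => Set.indicator_le_indicator_of_subset
      (bdryOmega_subset_tameNbhd_diff hred) hnn w
  have hsplit : ∑ w, (tameNbhd H G d x₀).indicator (boltzmann β H) w =
      ∑ w, (tameNbhd H G d x₀ \ Omega H red d x₀).indicator (boltzmann β H) w +
        ∑ w, (Omega H red d x₀).indicator (boltzmann β H) w := by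
    rw [← Finset.sum_add_distrib]
    refine Finset.sum_congr rfl fun w _ => ?_
    have hsub := Omega_subset_tameNbhd (H := H) (x₀ := x₀) hred hd
    by_cases hw : w ∈ Omega H red d x₀
    · simp [hw, hsub hw]
    · by_cases hw' : w ∈ tameNbhd H G d x₀ <;> simp [hw, hw']
  have hdiff : 0 ≤ ∑ w, (tameNbhd H G d x₀ \ Omega H red d x₀).indicator (boltzmann β H) w :=
    Finset.sum_nonneg fun w _ => Set.indicator_nonneg (fun x _ => hnn x) w
  unfold gibbs
  rw [div_div_div_cancel_right₀ hZ.ne', div_le_iff₀ hpos]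
  rw [hsplit] at hpeierls
  nlinarith [mul_le_mul_of_nonneg_right hq hdiff]

theorem one_sub_gibbs {m n : ℕ} (β : ℝ) (H : Matrix (Fin m) (Fin n) (ZMod 2))
    (S : Set (BitVect n)) : 1 - gibbs β H S = gibbs β H Sᶜ := by
  have hZ : 0 < ∑ x, boltzmann β H x :=
    Finset.sum_pos (fun x _ => boltzmann_pos β H x) ⟨0, Finset.mem_univ _⟩
  unfold gibbs
  rw [eq_div_iff hZ.ne', sub_mul, div_mul_cancel₀ _ hZ.ne', one_mul, ← Finset.sum_sub_distrib]
  refine Finset.sum_congr rfl fun x _ => ?_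
  rw [Set.indicator_compl, Pi.sub_apply]

theorem gibbs_nonneg {m n : ℕ} (β : ℝ) (H : Matrix (Fin m) (Fin n) (ZMod 2))
    (S : Set (BitVect n)) : 0 ≤ gibbs β H S :=
  div_nonneg (Finset.sum_nonneg fun w _ =>
    Set.indicator_nonneg (fun x _ => (boltzmann_pos β H x).le) w)
    (Finset.sum_nonneg fun x _ => (boltzmann_pos β H x).le)

theorem gibbs_mono {m n : ℕ} (β : ℝ) (H : Matrix (Fin m) (Fin n) (ZMod 2))
    {S T : Set (BitVect n)} (h : S ⊆ T) : gibbs β H S ≤ gibbs β H T :=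
  div_le_div_of_nonneg_right (Finset.sum_le_sum fun w _ =>
    Set.indicator_le_indicator_of_subset h (fun x => (boltzmann_pos β H x).le) w)
    (Finset.sum_nonneg fun x _ => (boltzmann_pos β H x).le)

/-- The bottleneck at finite size, with explicit constants. -/
theorem gibbs_no_bottleneck_le (hred : IsReduction G red) (hc : Confined H G d γ) (hγ : 0 < γ)
    (hGH : G * H.transpose = 0) (hr : H.rank = m) {wCheck wBit : ℕ}
    (hcheck : ∀ a, hammingNorm (fun j => H a j) ≤ wCheck)
    (hbit : ∀ j, hammingNorm (fun a => H a j) ≤ wBit) (hd : 0 < d)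
    (hn : 2 * (n : ℝ) ≤ Real.exp d)
    (hβ : 4 + ((wBit * wCheck : ℕ) + 2 + wBit) * Real.log 2 ≤ β * (γ / 44)) :
    1 - gibbs β H {x₀ | gibbs β H (bdryOmega H red d x₀) / gibbs β H (Omega H red d x₀) ≤
      Real.exp (-1 * d)} ≤ Real.exp (-1 * d) := by
  have hlog : 0 < Real.log 2 := Real.log_pos (by norm_num)
  have hw : (0 : ℝ) ≤ (wBit * wCheck : ℕ) := Nat.cast_nonneg _
  have hw' : (0 : ℝ) ≤ wBit := Nat.cast_nonneg _
  have hβ0 : 0 ≤ β := by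
    have h1 : 0 < β * (γ / 44) := lt_of_lt_of_le (by positivity) hβ
    exact (pos_of_mul_pos_left h1 (by positivity)).le
  -- Entropy is beaten by `4` per bit, and the sums run over sets of more than `d / 2` bits.
  have hexp : 2 * (n * Real.exp (-4 * (d / 2))) ≤ Real.exp (-1 * d) := by
    calc 2 * (n * Real.exp (-4 * (d / 2))) = (2 * n) * Real.exp (-4 * (d / 2)) := by ring
      _ ≤ Real.exp d * Real.exp (-4 * (d / 2)) := by gcongr
      _ = Real.exp (-1 * d) := by rw [← Real.exp_add]; congr 1; ring
  have hsum : ∀ a : ℝ, 4 + ((wBit * wCheck : ℕ) + 1) * Real.log 2 ≤ a →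
      2 * ∑ U ∈ connectedSets (bitGraph H) (d / 2), Real.exp (-a * U.card) ≤
        Real.exp (-1 * d) := by
    intro a ha
    have h1 := sum_connectedSets_le (card_adj_bitGraph_le hcheck hbit) (t := d / 2)
      (by norm_num) ha
    rw [Fintype.card_fin] at h1
    linarith
  have hq := hsum (β * (γ / 22) - Real.log 2) (by nlinarith)
  have hq' := hsum (β * (γ / 44) - wBit * Real.log 2) (by nlinarith)
  have hle1 : Real.exp (-1 * d) ≤ 1 := Real.exp_le_one_iff.2 (by linarith)
  have hnn : ∀ a : ℝ, 0 ≤ ∑ U ∈ connectedSets (bitGraph H) (d / 2), Real.exp (-a * U.card) :=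
    fun a => Finset.sum_nonneg fun _ _ => (Real.exp_pos _).le
  rw [one_sub_gibbs]
  refine le_trans (gibbs_mono β H (T := {x₀ | ¬ IsTypical H (γ / 44) (d / 2) (H.mulVec x₀)}) ?_)
    ((gibbs_atypical_le hr hbit hβ0).trans ?_)
  · intro x₀ hx₀ htyp
    refine hx₀ ?_
    have h1 := sum_tameNbhd_diff_le hred hc hγ hGH hβ0 htyp
    exact (gibbs_bdryOmega_div_le hred hd (by linarith) h1).trans hq
  · linarith [hnn (β * (γ / 44) - wBit * Real.log 2)]

end Bottleneck

/-- A monotone function dominating the logarithm tends to infinity. -/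
theorem tendsto_atTop_of_superlog {δ : ℕ → ℝ} (hmono : Monotone δ)
    (hlog : (fun n : ℕ => Real.log (n : ℝ)) =o[atTop] δ) : Tendsto δ atTop atTop := by
  have hlogtop : Tendsto (fun n : ℕ => Real.log (n : ℝ)) atTop atTop :=
    Real.tendsto_log_atTop.comp tendsto_natCast_atTop_atTop
  refine tendsto_atTop_mono' _ ?_ hlogtop
  filter_upwards [hlog.bound one_pos, hlogtop.eventually_gt_atTop (-δ 0),
    hlogtop.eventually_ge_atTop 0] with n h1 h2 h3
  rw [one_mul, Real.norm_eq_abs, Real.norm_eq_abs, abs_of_nonneg h3] at h1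
  rcases abs_cases (δ n) with h | h
  · linarith
  · linarith [hmono (Nat.zero_le n)]

theorem mainTheorem2
    (N m k : ℕ → ℕ) (hN : Tendsto N atTop atTop)
    (H : ∀ i, Matrix (Fin (m i)) (Fin (N i)) (ZMod 2))
    (G : ∀ i, Matrix (Fin (k i)) (Fin (N i)) (ZMod 2))
    (hCSS : ∀ i, G i * (H i).transpose = 0)
    (hrank : ∀ i, (H i).rank = m i)
    (hLDPC : IsLDPC H)
    (δ : ℕ → ℝ) (γ : ℝ) (hconf : HasLinearConfinement H G δ γ)
    (red : ∀ i, BitVect (N i) → BitVect (N i)) (hred : ∀ i, IsReduction (G i) (red i)) :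
    ∃ βstar c₁ c : ℝ, 0 < βstar ∧ 0 < c₁ ∧ 0 < c ∧
      (∀ β : ℝ, βstar < β →
        (fun i => 1 - gibbs β (H i)
          {x₀ | gibbs β (H i) (bdryOmega (H i) (red i) (δ (N i)) x₀) /
              gibbs β (H i) (Omega (H i) (red i) (δ (N i)) x₀) ≤ Real.exp (-c * δ (N i))})
          =O[atTop] fun i => Real.exp (-c₁ * δ (N i))) ∧
      Tendsto (fun i => Real.exp (-c * δ (N i))) atTop (𝓝 0) := by

  obtain ⟨wCheck, wBit, hw⟩ := hLDPC
  have hγ := hconf.gamma_pos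
  have hδ := tendsto_atTop_of_superlog hconf.mono hconf.superlog
  have hlog2 : 0 < Real.log 2 := Real.log_pos (by norm_num)
  have hsize : ∀ᶠ n : ℕ in atTop, 0 < δ n ∧ 2 * (n : ℝ) ≤ Real.exp (δ n) := by
    filter_upwards [hconf.superlog.bound (c := 1 / 2) (by norm_num),
      hδ.eventually_gt_atTop 0, hδ.eventually_ge_atTop (2 * Real.log 2),
      eventually_gt_atTop 0] with n h1 h2 h3 h4
    have hn : (0 : ℝ) < n := by exact_mod_cast h4
    refine ⟨h2, ?_⟩
    rw [← Real.log_le_iff_le_exp (by positivity), Real.log_mul (by norm_num) hn.ne']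
    rw [Real.norm_eq_abs, Real.norm_eq_abs, abs_of_pos h2] at h1
    linarith [le_abs_self (Real.log (n : ℝ))]
  refine ⟨44 / γ * (4 + ((wBit * wCheck : ℕ) + 2 + wBit) * Real.log 2), 1, 1, by positivity,
    one_pos, one_pos, fun β hβ => ?_, ?_⟩
  · refine IsBigO.of_bound 1 ?_
    filter_upwards [hN.eventually hsize] with i hi
    have hβ' : 4 + ((wBit * wCheck : ℕ) + 2 + wBit) * Real.log 2 ≤ β * (γ / 44) := by
      have h1 := mul_le_mul_of_nonneg_right hβ.le (show 0 ≤ γ / 44 by positivity)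
      refine le_trans (le_of_eq ?_) h1
      field_simp
    rw [one_mul, Real.norm_eq_abs, Real.norm_eq_abs, abs_of_pos (Real.exp_pos _), abs_of_nonneg]
    · exact gibbs_no_bottleneck_le (hred i) (hconf.confined i) hγ (hCSS i) (hrank i)
        (hw i).1 (hw i).2 hi.1 hi.2 hβ'
    · rw [one_sub_gibbs]
      exact gibbs_nonneg _ _ _
  · refine Real.tendsto_exp_atBot.comp ?_
    simp only [neg_one_mul]
    exact tendsto_neg_atTop_atBot.comp (hδ.comp hN)
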